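/- Let $n\ge 2$ and $m\ge 0$ be integers, let $\widetilde M^{n+m}(c)$ be a real space form, i.e. a smooth Riemannian manifold of dimension $n+m$ all of whose sectional curvatures are equal to the constant $c$, and let $f:M^n\to\widetilde M^{n+m}(c)$ be a smooth isometric immersion of a smooth Riemannian manifold of dimension $n$. Let $p\in M$, let $e_1,\dots,e_n$ be any orthonormal basis of $T_pM$ and $u_1,\dots,u_m$ any orthonormal basis of the normal space $T_p^\perp M$. Denote by $R$ the curvature tensor of $M$ (with the sign for which $\langle R(X,Y)Y,X\rangle$ is the sectional curvature for orthonormal $X,Y$), by $h$ the second fundamental form of $f$ and by $R^\perp$ the curvature tensor of its normal connection, and put $$\rho=\frac{2}{n(n-1)}\sum_{i<j}\langle R(e_i,e_j)e_j,e_i\rangle,\qquad H=\frac1n\sum_{i}h(e_i,e_i),\qquad \rho^\perp=\frac{2}{n(n-1)}\sqrt{\sum_{i<j}\ \sum_{\alpha<\beta}\langle R^\perp(e_i,e_j)u_\alpha,u_\beta\rangle^2}$$ (the normalized scalar curvature, the mean curvature vector and the normalized normal scalar curvature at $p$). Then (i) if $m\ge 2$, then $\displaystyle \rho\le\|H\|^2-\sqrt{\frac{2m-1}{3m-3}}\;\rho^\perp+c$;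 (ii) $\displaystyle \rho\le\|H\|^2-\sqrt{\frac23\,\frac{n^2+n-3}{n^2+n-4}}\;\rho^\perp+c$. -/

import Mathlib

open scoped Manifold ContDiff

noncomputable section

namespace Submfd

/-! ### Riemannian geometry in coordinates -/

/-- A field of bilinear forms on (an open subset of) `ℝᵏ`: `G x u v` is the value at the
point `x` on the vectors `u` and `v`. -/
abbrev CoordMetric (k : ℕ) : Type :=
  EuclideanSpace ℝ (Fin k) → EuclideanSpace ℝ (Fin k) → EuclideanSpace ℝ (Fin k) → ℝ

/-- The coordinate vector field `∂ᵢ`. -/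
def coordVec (k : ℕ) (i : Fin k) : EuclideanSpace ℝ (Fin k) := EuclideanSpace.single i 1

/-- The Gram matrix `(gᵢⱼ(x))` of a metric in coordinates. -/
def gram {k : ℕ} (G : CoordMetric k) (x : EuclideanSpace ℝ (Fin k)) : Matrix (Fin k) (Fin k) ℝ :=
  Matrix.of fun i j => G x (coordVec k i) (coordVec k j)

/-- Raising an index: `sharp G x α` is the vector with components `∑ₗ gⁱˡ α(∂ₗ)`, i.e. the
vector representing the linear form `α` with respect to the metric `G` at `x`. -/
def sharp {k : ℕ} (G : CoordMetric k) (x : EuclideanSpace ℝ (Fin k))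
    (α : EuclideanSpace ℝ (Fin k) → ℝ) : EuclideanSpace ℝ (Fin k) :=
  WithLp.toLp 2 fun i => ∑ l, (gram G x)⁻¹ i l * α (coordVec k l)

/-- The Christoffel symbol of the Levi-Civita connection, as a bilinear map:
`christoffel G x u v = ∑ uⁱ vʲ Γᵏᵢⱼ(x) ∂ₖ`, where
`Γᵏᵢⱼ = ½ ∑ₗ gᵏˡ (∂ᵢ gⱼₗ + ∂ⱼ gᵢₗ - ∂ₗ gᵢⱼ)`. -/
def christoffel {k : ℕ} (G : CoordMetric k) (x u v : EuclideanSpace ℝ (Fin k)) :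
    EuclideanSpace ℝ (Fin k) :=
  sharp G x fun w =>
    (fderiv ℝ (fun y => G y v w) x u + fderiv ℝ (fun y => G y u w) x v
      - fderiv ℝ (fun y => G y u v) x w) / 2

/-- The Riemann-Christoffel curvature tensor `R(u,v)w = ∇ᵤ∇ᵥw - ∇ᵥ∇ᵤw - ∇_[u,v] w` in coordinates
(the vectors being extended with constant coefficients). -/
def coordCurvature {k : ℕ} (G : CoordMetric k) (x u v w : EuclideanSpace ℝ (Fin k)) :
    EuclideanSpace ℝ (Fin k) :=
  fderiv ℝ (fun y => christoffel G y v w) x u - fderiv ℝ (fun y => christoffel G y u w) x v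
    + christoffel G x u (christoffel G x v w) - christoffel G x v (christoffel G x u w)

/-! ### Submanifold geometry in coordinates

Here `F` is a map from an open subset of `ℝⁿ` to an open subset of `ℝᵏ` carrying the metric `G`. -/

section Coord

variable {n k : ℕ}

/-- The metric induced by `F`. -/
def inducedMetric (G : CoordMetric k) (F : EuclideanSpace ℝ (Fin n) → EuclideanSpace ℝ (Fin k)) :
    CoordMetric n :=
  fun x u v => G (F x) (fderiv ℝ F x u) (fderiv ℝ F x v)

/-- The component of `W` (a vector at the point `F x`) that is normal to the image of `dFₓ`: `W`
minus its orthogonal projection onto that image. -/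
def normalPart (G : CoordMetric k) (F : EuclideanSpace ℝ (Fin n) → EuclideanSpace ℝ (Fin k))
    (x : EuclideanSpace ℝ (Fin n)) (W : EuclideanSpace ℝ (Fin k)) : EuclideanSpace ℝ (Fin k) :=
  W - fderiv ℝ F x (sharp (inducedMetric G F) x fun w => G (F x) W (fderiv ℝ F x w))

/-- The covariant derivative, with respect to the Levi-Civita connection of `G`, of a vector field
`W` along `F` in the direction `u` at `x`. -/
def covDerivAlong (G : CoordMetric k) (F : EuclideanSpace ℝ (Fin n) → EuclideanSpace ℝ (Fin k))
    (W : EuclideanSpace ℝ (Fin n) → EuclideanSpace ℝ (Fin k))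
    (x u : EuclideanSpace ℝ (Fin n)) : EuclideanSpace ℝ (Fin k) :=
  fderiv ℝ W x u + christoffel G (F x) (fderiv ℝ F x u) (W x)

/-- The second fundamental form: `h(u,v)` is the normal part of the ambient covariant derivative
in the direction `u` of the tangent field `dF(v)`. -/
def coordSecondFundamentalForm (G : CoordMetric k)
    (F : EuclideanSpace ℝ (Fin n) → EuclideanSpace ℝ (Fin k))
    (x u v : EuclideanSpace ℝ (Fin n)) : EuclideanSpace ℝ (Fin k) :=
  normalPart G F x (covDerivAlong G F (fun y => fderiv ℝ F y v) x u)

/-- The normal connection: the normal part of the ambient covariant derivative of a normal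
field `ξ` along `F`. -/
def normalDeriv (G : CoordMetric k) (F : EuclideanSpace ℝ (Fin n) → EuclideanSpace ℝ (Fin k))
    (ξ : EuclideanSpace ℝ (Fin n) → EuclideanSpace ℝ (Fin k))
    (x u : EuclideanSpace ℝ (Fin n)) : EuclideanSpace ℝ (Fin k) :=
  normalPart G F x (covDerivAlong G F ξ x u)

/-- The curvature tensor of the normal connection, `R^⊥(u,v)ξ = ∇^⊥ᵤ∇^⊥ᵥξ - ∇^⊥ᵥ∇^⊥ᵤξ - ∇^⊥_[u,v]ξ`,
where `u`, `v` are extended with constant coefficients and the normal vector `ξ` is extended to the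
normal field `y ↦ (normal part of ξ at y)`. -/
def coordNormalCurvature (G : CoordMetric k)
    (F : EuclideanSpace ℝ (Fin n) → EuclideanSpace ℝ (Fin k))
    (x u v : EuclideanSpace ℝ (Fin n)) (ξ : EuclideanSpace ℝ (Fin k)) :
    EuclideanSpace ℝ (Fin k) :=
  normalDeriv G F (fun y => normalDeriv G F (fun z => normalPart G F z ξ) y v) x u
    - normalDeriv G F (fun y => normalDeriv G F (fun z => normalPart G F z ξ) y u) x v

end Coord

/-! ### Riemannian manifolds

Tensors at a point `p` are computed in the preferred chart `extChartAt (𝓡 n) p`. In Mathlib the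
tangent space at `p` is by construction the model space, identified through the differential of
that chart, so that a tangent vector at `p` and its coordinate vector are the same. -/

section Manifold

variable {n k : ℕ}
  {M : Type*} [TopologicalSpace M] [ChartedSpace (EuclideanSpace ℝ (Fin n)) M]
  [IsManifold (𝓡 n) ∞ M]
  {N : Type*} [TopologicalSpace N] [ChartedSpace (EuclideanSpace ℝ (Fin k)) N]
  [IsManifold (𝓡 k) ∞ N]

variable (n M) in
/-- Smooth Riemannian metrics on the `n`-dimensional manifold `M`. -/
abbrev SmoothMetric : Type _ :=
  Bundle.ContMDiffRiemannianMetric (𝓡 n) ∞ (EuclideanSpace ℝ (Fin n))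
    (fun x : M => TangentSpace (𝓡 n) x)

/-- The expression of the metric `g` in the chart at `p`. -/
def chartMetric (g : SmoothMetric n M) (p : M) : CoordMetric n := fun x u v =>
  g.inner ((extChartAt (𝓡 n) p).symm x)
    (mfderiv 𝓘(ℝ, EuclideanSpace ℝ (Fin n)) (𝓡 n) (extChartAt (𝓡 n) p).symm x u)
    (mfderiv 𝓘(ℝ, EuclideanSpace ℝ (Fin n)) (𝓡 n) (extChartAt (𝓡 n) p).symm x v)

/-- The Riemann-Christoffel curvature tensor of `g` at `p`. -/
def curvature (g : SmoothMetric n M) (p : M) (X Y Z : TangentSpace (𝓡 n) p) :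
    TangentSpace (𝓡 n) p :=
  coordCurvature (chartMetric g p) (extChartAt (𝓡 n) p p) X Y Z

/-- The sectional curvature of the plane spanned by the linearly independent vectors `X`, `Y`. -/
def sectionalCurvature (g : SmoothMetric n M) (p : M) (X Y : TangentSpace (𝓡 n) p) : ℝ :=
  g.inner p (curvature g p X Y Y) X
    / (g.inner p X X * g.inner p Y Y - g.inner p X Y ^ 2)

/-- `(M, g)` is a real space form of constant sectional curvature `c`. -/
def IsRealSpaceForm (g : SmoothMetric n M) (c : ℝ) : Prop :=
  ∀ (p : M) (X Y : TangentSpace (𝓡 n) p),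
    LinearIndependent ℝ ![X, Y] → sectionalCurvature g p X Y = c

/-- `f : (M, g) → (N, g')` is a (smooth) isometric immersion. -/
structure IsIsometricImmersion (g : SmoothMetric n M) (g' : SmoothMetric k N) (f : M → N) :
    Prop where
  contMDiff : ContMDiff (𝓡 n) (𝓡 k) ∞ f
  isometric : ∀ (p : M) (X Y : TangentSpace (𝓡 n) p),
    g'.inner (f p) (mfderiv (𝓡 n) (𝓡 k) f p X) (mfderiv (𝓡 n) (𝓡 k) f p Y) = g.inner p X Y

/-- The second fundamental form of `f` at `p`. -/
def secondFundamentalForm (g' : SmoothMetric k N) (f : M → N) (p : M)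
    (X Y : TangentSpace (𝓡 n) p) : TangentSpace (𝓡 k) (f p) :=
  coordSecondFundamentalForm (chartMetric g' (f p)) (writtenInExtChartAt (𝓡 n) (𝓡 k) p f)
    (extChartAt (𝓡 n) p p) X Y

/-- The curvature tensor `R^⊥(X,Y)ξ` of the normal connection of `f` at `p`. -/
def normalCurvature (g' : SmoothMetric k N) (f : M → N) (p : M)
    (X Y : TangentSpace (𝓡 n) p) (ξ : TangentSpace (𝓡 k) (f p)) : TangentSpace (𝓡 k) (f p) :=
  coordNormalCurvature (chartMetric g' (f p)) (writtenInExtChartAt (𝓡 n) (𝓡 k) p f)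
    (extChartAt (𝓡 n) p p) X Y ξ

/-- `e₁, …, eₙ` is an orthonormal basis of `T_pM` (`n` orthonormal vectors, `n = dim M`). -/
def IsOrthonormalFrame (g : SmoothMetric n M) (p : M) (e : Fin n → TangentSpace (𝓡 n) p) : Prop :=
  ∀ i j, g.inner p (e i) (e j) = if i = j then 1 else 0

/-- `u₁, …, uₘ` is an orthonormal basis of the normal space `T_p^⊥M` of the immersion
`f : Mⁿ → N^(n+m)` (`m` orthonormal normal vectors, `m` being the codimension). -/
structure IsOrthonormalNormalFrame {m : ℕ} {N : Type*} [TopologicalSpace N]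
    [ChartedSpace (EuclideanSpace ℝ (Fin (n + m))) N] [IsManifold (𝓡 (n + m)) ∞ N]
    (g' : SmoothMetric (n + m) N) (f : M → N) (p : M)
    (u : Fin m → TangentSpace (𝓡 (n + m)) (f p)) : Prop where
  orthonormal : ∀ α β, g'.inner (f p) (u α) (u β) = if α = β then 1 else 0
  normal : ∀ (α : Fin m) (X : TangentSpace (𝓡 n) p),
    g'.inner (f p) (u α) (mfderiv (𝓡 n) (𝓡 (n + m)) f p X) = 0

/-- The normalized scalar curvature
`ρ = 2 / (n (n - 1)) * ∑_{i<j} ⟨R(eᵢ,eⱼ)eⱼ, eᵢ⟩` at `p`, computed in the orthonormal basis `e`. -/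
def normalizedScalarCurvature (g : SmoothMetric n M) (p : M)
    (e : Fin n → TangentSpace (𝓡 n) p) : ℝ :=
  2 / ((n : ℝ) * ((n : ℝ) - 1)) *
    ∑ i, ∑ j ∈ Finset.Ioi i, g.inner p (curvature g p (e i) (e j) (e j)) (e i)

/-- The normalized normal scalar curvature
`ρ^⊥ = 2 / (n (n - 1)) * √(∑_{i<j} ∑_{α<β} ⟨R^⊥(eᵢ,eⱼ)u_α, u_β⟩²)` at `p`, computed in the
orthonormal bases `e` and `u` of the tangent and the normal space. -/
def normalizedNormalScalarCurvature {m : ℕ} (g' : SmoothMetric k N) (f : M → N) (p : M)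
    (e : Fin n → TangentSpace (𝓡 n) p) (u : Fin m → TangentSpace (𝓡 k) (f p)) : ℝ :=
  2 / ((n : ℝ) * ((n : ℝ) - 1)) *
    √(∑ i, ∑ j ∈ Finset.Ioi i, ∑ α, ∑ β ∈ Finset.Ioi α,
      g'.inner (f p) (normalCurvature g' f p (e i) (e j) (u α)) (u β) ^ 2)

/-- The mean curvature vector `H = (1/n) ∑ᵢ h(eᵢ,eᵢ)` at `p`, computed in the orthonormal
basis `e`. -/
def meanCurvatureVector (g' : SmoothMetric k N) (f : M → N) (p : M)
    (e : Fin n → TangentSpace (𝓡 n) p) : TangentSpace (𝓡 k) (f p) :=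
  (1 / (n : ℝ)) • ∑ i, secondFundamentalForm g' f p (e i) (e i)

/-- The squared length `‖H‖²` of the mean curvature vector. -/
def meanCurvatureSq (g' : SmoothMetric k N) (f : M → N) (p : M)
    (e : Fin n → TangentSpace (𝓡 n) p) : ℝ :=
  g'.inner (f p) (meanCurvatureVector g' f p e) (meanCurvatureVector g' f p e)

end Manifold

end Submfd

end

/-! At the point p let A_α be the matrices of the shape operators in the given frames. In a space
form the Gauss equation gives ⟨R(e_i,e_j)e_j,e_i⟩ = c + Σ_α (A_α,ii A_α,jj − A_α,ij²) for i ≠ j. The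
Ricci equation has no ambient term, so ⟨R^⊥(e_i,e_j)u_α,u_β⟩ is the (i,j) entry of [A_β,A_α].
Removing traces, B_α = A_α − (tr A_α/n) I, does not change commutators. Then ‖H‖² + c − ρ =
Σ|B_α|²/(n(n−1)) and ρ^⊥ = √(Σ|[B_α,B_β]|²)/(n(n−1)), with Frobenius norms. The theorem is thus λ √X
≤ T for traceless symmetric matrices, where T = Σ|B_α|² and X = Σ|[B_α,B_β]|²
(`normalized_scalar_le_of_shape`).

Put S = Σ⟨B_α,B_β⟩². The engine is the inequality X + S ≤ (3/2) T² (`sum_frobSq_commutator_add_le`).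
Moreover T² ≤ d·S, both for d = m (`sq_sum_frobSq_le_card`) and for d = (n²+n−2)/2, the dimension of
the space of traceless symmetric matrices (`sq_sum_frobSq_le_dim`). Hence X ≤ (3/2 − 1/d) T², which
for d ≥ 2 implies λ √X ≤ T with λ² = (2d−1)/(3d−3). The two values of d give the two constants.

To bound X + S, rotate the family so that it becomes Frobenius orthogonal. For a symmetric A and an
orthogonal family with |B_β|² ≤ K one has Σ|[A,B_β]|² ≤ |A|²(Σ|B_β|² + K)
(`sum_frobSq_commutator_le`): diagonalise A and combine Bessel's inequality with the bound E + 1 for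
the Laplacian eigenvalues of a graph with E edges. Adding the matrices in order of increasing norm
turns this into a bound on all commutators.

The geometric half proves the Gauss and Ricci equations in coordinates for smooth bundled
Christoffel symbols, identifies these with the coordinate definitions, and moves the result to the
manifold through the preferred charts. -/

noncomputable section

namespace Submfd

/-! ### Commutator inequalities for families of symmetric matrices. -/

section MatrixInequality

open Finset Matrix

/-- If the synthesis operator `x ↦ ∑ xₑ vₑ` has squared norm at most `C`, so has its adjoint. -/
theorem sum_sq_dot_le_of_synthesis {κ σ : Type*} [Fintype σ] (v : κ → σ → ℝ) (s : Finset κ)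
    {C : ℝ} (hC : 0 ≤ C)
    (h : ∀ x : κ → ℝ, ∑ t, (∑ e ∈ s, x e * v e t) ^ 2 ≤ C * ∑ e ∈ s, x e ^ 2) (η : σ → ℝ) :
    ∑ e ∈ s, (∑ t, η t * v e t) ^ 2 ≤ C * ∑ t, η t ^ 2 := by
  -- Test the synthesis bound on x = V*η: |x|² = ⟨η, Vx⟩, so Cauchy–Schwarz gives |x|⁴ ≤ |η|² ·
  -- C|x|², and |x|² cancels unless it is zero.
  set x : κ → ℝ := fun e => ∑ t, η t * v e t with hx
  have h1 : ∑ e ∈ s, x e ^ 2 = ∑ t, η t * ∑ e ∈ s, x e * v e t := by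
    simp_rw [Finset.mul_sum]
    rw [Finset.sum_comm]
    refine Finset.sum_congr rfl fun e _ => ?_
    rw [sq]
    nth_rw 2 [hx]
    rw [Finset.mul_sum]
    exact Finset.sum_congr rfl fun t _ => by ring
  have h2 := Finset.sum_mul_sq_le_sq_mul_sq univ η (fun t => ∑ e ∈ s, x e * v e t)
  rw [← h1] at h2
  have h3 := h x
  have hη : 0 ≤ ∑ t, η t ^ 2 := Finset.sum_nonneg fun _ _ => sq_nonneg _
  rcases (Finset.sum_nonneg fun e (_ : e ∈ s) => sq_nonneg (x e)).eq_or_lt with h0 | h0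
  · rw [← h0]; positivity
  · refine le_of_mul_le_mul_right ?_ h0
    nlinarith [mul_le_mul_of_nonneg_left h3 hη]

/-- Bessel's inequality: for orthogonal vectors the Gram matrix is diagonal, so the synthesis
operator is bounded by the largest squared norm. -/
theorem sum_sq_dot_le_of_orthogonal {κ σ : Type*} [Fintype σ] (v : κ → σ → ℝ) (s : Finset κ)
    {C : ℝ} (hC : 0 ≤ C) (hn : ∀ e ∈ s, ∑ t, v e t ^ 2 ≤ C)
    (ho : ∀ e ∈ s, ∀ f ∈ s, e ≠ f → ∑ t, v e t * v f t = 0) (η : σ → ℝ) :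
    ∑ e ∈ s, (∑ t, η t * v e t) ^ 2 ≤ C * ∑ t, η t ^ 2 := by
  classical
  refine sum_sq_dot_le_of_synthesis v s hC (fun x => ?_) η
  have h1 : ∑ t, (∑ e ∈ s, x e * v e t) ^ 2
      = ∑ e ∈ s, ∑ f ∈ s, x e * x f * ∑ t, v e t * v f t := by
    simp_rw [sq, Finset.sum_mul_sum, Finset.mul_sum]
    rw [Finset.sum_comm]
    refine Finset.sum_congr rfl fun e _ => ?_
    rw [Finset.sum_comm]
    exact Finset.sum_congr rfl fun f _ => Finset.sum_congr rfl fun t _ => by ring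
  rw [h1, Finset.mul_sum]
  refine Finset.sum_le_sum fun e he => ?_
  rw [Finset.sum_eq_single_of_mem e he
    (fun f hf hfe => by rw [ho e he f hf (Ne.symm hfe), mul_zero])]
  have := mul_le_mul_of_nonneg_left (hn e he) (sq_nonneg (x e))
  simp only [sq] at this ⊢
  linarith

/-- The Gram matrix is dominated entrywise by J + I, with J the all-ones matrix. Its quadratic form
at x is therefore at most (Σ|x_e|)² + Σ x_e², and Cauchy–Schwarz bounds the first term by #s Σ x_e².
-/
theorem sum_sq_dot_le_of_nearly_orthogonal {κ σ : Type*} [Fintype σ] (v : κ → σ → ℝ)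
    (s : Finset κ) (hn : ∀ e ∈ s, ∑ t, v e t ^ 2 ≤ 2)
    (ho : ∀ e ∈ s, ∀ f ∈ s, e ≠ f → |∑ t, v e t * v f t| ≤ 1) (η : σ → ℝ) :
    ∑ e ∈ s, (∑ t, η t * v e t) ^ 2 ≤ (#s + 1) * ∑ t, η t ^ 2 := by
  classical
  refine sum_sq_dot_le_of_synthesis v s (by positivity) (fun x => ?_) η
  have h1 : ∑ t, (∑ e ∈ s, x e * v e t) ^ 2
      = ∑ e ∈ s, ∑ f ∈ s, x e * x f * ∑ t, v e t * v f t := by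
    simp_rw [sq, Finset.sum_mul_sum, Finset.mul_sum]
    rw [Finset.sum_comm]
    refine Finset.sum_congr rfl fun e _ => ?_
    rw [Finset.sum_comm]
    exact Finset.sum_congr rfl fun f _ => Finset.sum_congr rfl fun t _ => by ring
  have h2 : ∑ e ∈ s, ∑ f ∈ s, x e * x f * ∑ t, v e t * v f t
      ≤ ∑ e ∈ s, ∑ f ∈ s, (|x e| * |x f| + if e = f then x e ^ 2 else 0) := by
    refine Finset.sum_le_sum fun e he => Finset.sum_le_sum fun f hf => ?_
    by_cases hef : e = f
    · subst hef
      have h3 := mul_le_mul_of_nonneg_left (hn e he) (sq_nonneg (x e))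
      rw [if_pos rfl, ← abs_mul, abs_mul_self]
      simp only [sq] at h3 ⊢
      linarith
    · rw [if_neg hef, add_zero, ← abs_mul]
      refine (le_abs_self _).trans ?_
      rw [abs_mul]
      exact mul_le_of_le_one_right (abs_nonneg _) (ho e he f hf hef)
  have h3 : ∑ e ∈ s, ∑ f ∈ s, (|x e| * |x f| + if e = f then x e ^ 2 else 0)
      = (∑ e ∈ s, |x e|) ^ 2 + ∑ e ∈ s, x e ^ 2 := by
    simp_rw [Finset.sum_add_distrib]
    rw [sq, Finset.sum_mul_sum]
    congr 1
    refine Finset.sum_congr rfl fun e he => ?_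
    rw [Finset.sum_ite_eq, if_pos he]
  have h4 := sq_sum_le_card_mul_sum_sq (s := s) (f := fun e => |x e|)
  simp only [sq_abs] at h4
  rw [h1]
  linarith

/-- The largest Laplacian eigenvalue of a graph with `E` edges is at most `E + 1`. -/
theorem sum_sq_sub_le_card_add_one {n : ℕ} (η : Fin n → ℝ) (s : Finset (Fin n × Fin n))
    (hs : ∀ e ∈ s, e.1 < e.2) :
    ∑ e ∈ s, (η e.1 - η e.2) ^ 2 ≤ (#s + 1) * ∑ i, η i ^ 2 := by
  classical
  -- The vectors are the rows δ_a − δ_b of the oriented incidence matrix.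
  have key := sum_sq_dot_le_of_nearly_orthogonal
    (fun (e : Fin n × Fin n) t => (if t = e.1 then (1 : ℝ) else 0) - if t = e.2 then 1 else 0) s
    ?_ ?_ η
  · simpa [mul_sub, Finset.sum_sub_distrib] using key
  · intro e he
    have := (hs e he).ne
    simp [sq, mul_sub, Finset.sum_sub_distrib, this, this.symm]
    norm_num
  · rintro ⟨a, b⟩ he ⟨c, d⟩ hf hne
    have h1 := hs _ he
    have h2 := hs _ hf
    simp only [ne_eq, Prod.mk.injEq, not_and] at hne h1 h2 ⊢
    simp only [mul_sub, Finset.sum_sub_distrib, mul_ite, mul_one, mul_zero,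
      Finset.sum_ite_eq', Finset.mem_univ, if_true]
    rw [abs_le]
    -- An inner product ±2 would need two edges with the same endpoints. Since edges are listed in
    -- increasing orientation, this cannot happen for distinct ones.
    split_ifs <;> first | (norm_num; done) | (exfalso; subst_vars; omega)

theorem sum_sum_eq_diag_add_two_mul {n : ℕ} (f : Fin n → Fin n → ℝ) (hf : ∀ i j, f i j = f j i) :
    ∑ i, ∑ j, f i j = ∑ i, f i i + 2 * ∑ i, ∑ j ∈ Ioi i, f i j := by
  classical
  have h1 : ∀ i j, f i j = (if i = j then f i j else 0) + (if i < j then f i j else 0)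
      + (if j < i then f i j else 0) := by
    intro i j
    rcases lt_trichotomy i j with h | h | h
    · simp [h, h.ne, h.not_gt]
    · simp [h]
    · simp [h, h.ne', h.not_gt]
  have h2 : ∀ i, ∑ j ∈ Ioi i, f i j = ∑ j, if i < j then f i j else 0 := by
    intro i
    rw [← Finset.sum_filter]
    exact Finset.sum_congr (by ext; simp) fun _ _ => rfl
  have h3 : ∑ i, ∑ j, (if j < i then f i j else 0) = ∑ i, ∑ j, if i < j then f i j else 0 := by
    rw [Finset.sum_comm]
    exact Finset.sum_congr rfl fun i _ => Finset.sum_congr rfl fun j _ => by rw [hf j i]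
  simp_rw [h2]
  calc ∑ i, ∑ j, f i j = ∑ i, ∑ j, ((if i = j then f i j else 0) + (if i < j then f i j else 0)
      + (if j < i then f i j else 0)) :=
        Finset.sum_congr rfl fun i _ => Finset.sum_congr rfl fun j _ => h1 i j
    _ = _ := by
        simp_rw [Finset.sum_add_distrib]
        rw [h3]
        simp
        ring

theorem sum_sum_Ioi_eq_sum_filter {n : ℕ} (f : Fin n → Fin n → ℝ) :
    ∑ i, ∑ j ∈ Ioi i, f i j
      = ∑ e ∈ (univ : Finset (Fin n × Fin n)).filter (fun e => e.1 < e.2), f e.1 e.2 := by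
  rw [Finset.sum_filter, Fintype.sum_prod_type]
  refine Finset.sum_congr rfl fun i _ => ?_
  rw [← Finset.sum_filter]
  exact Finset.sum_congr (by ext; simp) fun _ _ => rfl

/-- The squared Frobenius norm. -/
def frobSq {n : ℕ} (A : Matrix (Fin n) (Fin n) ℝ) : ℝ := ∑ i, ∑ j, A i j ^ 2

/-- The Frobenius inner product. -/
def frobInner {n : ℕ} (A B : Matrix (Fin n) (Fin n) ℝ) : ℝ := ∑ i, ∑ j, A i j * B i j

theorem frobInner_self {n : ℕ} (A : Matrix (Fin n) (Fin n) ℝ) : frobInner A A = frobSq A := by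
  simp [frobInner, frobSq, sq]

theorem frobSq_nonneg {n : ℕ} (A : Matrix (Fin n) (Fin n) ℝ) : 0 ≤ frobSq A :=
  Finset.sum_nonneg fun _ _ => Finset.sum_nonneg fun _ _ => sq_nonneg _

theorem frobInner_eq_trace {n : ℕ} (A B : Matrix (Fin n) (Fin n) ℝ) :
    frobInner A B = (Aᵀ * B).trace := by
  simp only [frobInner, Matrix.trace, Matrix.diag, Matrix.mul_apply, Matrix.transpose_apply]
  exact Finset.sum_comm

theorem frobInner_conj {n : ℕ} {U : Matrix (Fin n) (Fin n) ℝ} (hU : U * Uᵀ = 1)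
    (A B : Matrix (Fin n) (Fin n) ℝ) : frobInner (Uᵀ * A * U) (Uᵀ * B * U) = frobInner A B := by
  rw [frobInner_eq_trace, frobInner_eq_trace]
  have : (Uᵀ * A * U)ᵀ * (Uᵀ * B * U) = Uᵀ * (Aᵀ * ((U * Uᵀ) * B) * U) := by
    simp [Matrix.transpose_mul, Matrix.mul_assoc]
  rw [this, hU, Matrix.one_mul, Matrix.trace_mul_comm, Matrix.mul_assoc, hU, Matrix.mul_one]

/-- With a = |η|² and b_ij = Σ_β B_β,ij² the left side is Σ(η_i−η_j)² b_ij. Only pairs with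
(η_i−η_j)² > a push it above a Σ b_ij. For them Bessel gives 2b_ij ≤ K, and the Laplacian bound for
the graph of these pairs limits the total excess to Ka. -/
theorem sum_sq_sub_mul_le_of_orthogonal {n : ℕ} {κ : Type*} (η : Fin n → ℝ)
    (B : κ → Matrix (Fin n) (Fin n) ℝ) (s : Finset κ) (hB : ∀ β ∈ s, (B β).IsSymm)
    (ho : ∀ β ∈ s, ∀ γ ∈ s, β ≠ γ → frobInner (B β) (B γ) = 0) {K : ℝ} (hK : 0 ≤ K)
    (hBK : ∀ β ∈ s, frobSq (B β) ≤ K) :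
    ∑ β ∈ s, ∑ i, ∑ j, ((η i - η j) * B β i j) ^ 2
      ≤ (∑ i, η i ^ 2) * (∑ β ∈ s, frobSq (B β) + K) := by
  classical
  set a := ∑ i, η i ^ 2 with ha
  have ha0 : 0 ≤ a := Finset.sum_nonneg fun _ _ => sq_nonneg _
  set b : Fin n → Fin n → ℝ := fun i j => ∑ β ∈ s, B β i j ^ 2 with hb
  have hb0 : ∀ i j, 0 ≤ b i j := fun i j => Finset.sum_nonneg fun _ _ => sq_nonneg _
  have hbs : ∀ i j, b i j = b j i := fun i j =>
    Finset.sum_congr rfl fun β hβ => by rw [(hB β hβ).apply i j]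
  have hbessel : ∀ i j, i ≠ j → 2 * b i j ≤ K := by
    intro i j hij
    -- Bessel is tested on E_ij + E_ji, whose squared norm is 2 and whose pairing with a symmetric B
    -- is 2B_ij; so 4 b_ij ≤ 2K.
    have h := sum_sq_dot_le_of_orthogonal (fun β (t : Fin n × Fin n) => B β t.1 t.2) s hK
      (fun β hβ => by
        have := hBK β hβ
        rw [frobSq] at this
        rwa [Fintype.sum_prod_type])
      (fun β hβ γ hγ hne => by
        have := ho β hβ γ hγ hne
        rw [frobInner] at this
        rwa [Fintype.sum_prod_type])
      (fun t => (if t = (i, j) then 1 else 0) + if t = (j, i) then 1 else 0)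
    have h1 : ∑ t : Fin n × Fin n, ((if t = (i, j) then (1 : ℝ) else 0)
        + if t = (j, i) then 1 else 0) ^ 2 = 2 := by
      simp only [sq, mul_add, Finset.sum_add_distrib,
        mul_ite, mul_one, mul_zero]
      simp [hij, hij.symm]
      norm_num
    rw [h1] at h
    have h2 : ∀ β ∈ s, (∑ t : Fin n × Fin n, ((if t = (i, j) then (1 : ℝ) else 0)
        + if t = (j, i) then 1 else 0) * B β t.1 t.2) ^ 2 = 4 * B β i j ^ 2 := by
      intro β hβ
      simp only [add_mul, Finset.sum_add_distrib, ite_mul, one_mul, zero_mul, Finset.sum_ite_eq',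
        Finset.mem_univ, if_true]
      rw [(hB β hβ).apply i j]
      ring
    rw [Finset.sum_congr rfl h2, ← Finset.mul_sum] at h
    simp only [hb]
    linarith
  have hL : ∑ β ∈ s, ∑ i, ∑ j, ((η i - η j) * B β i j) ^ 2
      = ∑ i, ∑ j, (η i - η j) ^ 2 * b i j := by
    rw [Finset.sum_comm]
    refine Finset.sum_congr rfl fun i _ => ?_
    rw [Finset.sum_comm]
    refine Finset.sum_congr rfl fun j _ => ?_
    rw [hb, Finset.mul_sum]
    exact Finset.sum_congr rfl fun β _ => by ring
  have hR : ∑ β ∈ s, frobSq (B β) = ∑ i, ∑ j, b i j := by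
    simp only [frobSq]
    rw [Finset.sum_comm]
    refine Finset.sum_congr rfl fun i _ => ?_
    rw [Finset.sum_comm]
  have hmain : ∑ i, ∑ j, ((η i - η j) ^ 2 - a) * b i j ≤ K * a := by
    rw [sum_sum_eq_diag_add_two_mul _ (fun i j => by rw [hbs i j]; ring),
      sum_sum_Ioi_eq_sum_filter]
    set E := (univ : Finset (Fin n × Fin n)).filter (fun e => e.1 < e.2) with hE
    -- The graph of the pairs with positive coefficient; dropping the others can only increase the
    -- sum.
    set E' := E.filter (fun e => a < (η e.1 - η e.2) ^ 2) with hE'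
    have h1 : ∑ i, ((η i - η i) ^ 2 - a) * b i i ≤ 0 := by
      refine Finset.sum_nonpos fun i _ => ?_
      have := mul_nonneg ha0 (hb0 i i)
      rw [sub_self]; linarith
    have h2 : ∑ e ∈ E, ((η e.1 - η e.2) ^ 2 - a) * b e.1 e.2
        ≤ ∑ e ∈ E', ((η e.1 - η e.2) ^ 2 - a) * b e.1 e.2 := by
      rw [hE', Finset.sum_filter (s := E)]
      refine Finset.sum_le_sum fun e _ => ?_
      split_ifs with h
      · exact le_rfl
      · exact mul_nonpos_of_nonpos_of_nonneg (by linarith) (hb0 _ _)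
    have hlt : ∀ e ∈ E', e.1 < e.2 := fun e he =>
      (Finset.mem_filter.1 (Finset.mem_filter.1 he).1).2
    have h3 : 2 * ∑ e ∈ E', ((η e.1 - η e.2) ^ 2 - a) * b e.1 e.2
        ≤ ∑ e ∈ E', ((η e.1 - η e.2) ^ 2 - a) * K := by
      rw [Finset.mul_sum]
      refine Finset.sum_le_sum fun e he => ?_
      have h0 : 0 ≤ (η e.1 - η e.2) ^ 2 - a := by linarith [(Finset.mem_filter.1 he).2]
      have := mul_le_mul_of_nonneg_left (hbessel e.1 e.2 (hlt e he).ne) h0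
      linarith
    have h4 := sum_sq_sub_le_card_add_one η E' hlt
    rw [← Finset.sum_mul, Finset.sum_sub_distrib, Finset.sum_const, nsmul_eq_mul] at h3
    -- The E edges absorb #E' copies of a; the extra 1 in the eigenvalue bound #E' + 1 is what
    -- remains, namely a.
    have h5 : (∑ e ∈ E', (η e.1 - η e.2) ^ 2 - #E' * a) * K ≤ a * K :=
      mul_le_mul_of_nonneg_right (by linarith) hK
    linarith
  rw [hL, hR, mul_add, Finset.mul_sum]
  simp_rw [Finset.mul_sum]
  simp_rw [sub_mul, Finset.sum_sub_distrib] at hmain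
  linarith

theorem exists_orthogonal_diagonalization {n : ℕ} {A : Matrix (Fin n) (Fin n) ℝ}
    (hA : A.IsSymm) : ∃ (U : Matrix (Fin n) (Fin n) ℝ) (η : Fin n → ℝ),
      U * Uᵀ = 1 ∧ Uᵀ * U = 1 ∧ Uᵀ * A * U = diagonal η := by
  have hA' : A.IsHermitian := by
    rw [Matrix.IsHermitian, Matrix.conjTranspose_eq_transpose_of_trivial]; exact hA
  set U : Matrix (Fin n) (Fin n) ℝ := hA'.eigenvectorUnitary.1 with hU
  have hs : star U = Uᵀ := by
    rw [Matrix.star_eq_conjTranspose, Matrix.conjTranspose_eq_transpose_of_trivial]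
  have h1 : U * Uᵀ = 1 := by rw [← hs]; exact Unitary.mul_star_self_of_mem hA'.eigenvectorUnitary.2
  have h2 : Uᵀ * U = 1 := by rw [← hs]; exact Unitary.star_mul_self_of_mem hA'.eigenvectorUnitary.2
  refine ⟨U, hA'.eigenvalues, h1, h2, ?_⟩
  have h3 := hA'.spectral_theorem
  rw [Unitary.conjStarAlgAut_apply, ← hU, hs] at h3
  have h4 : diagonal (RCLike.ofReal ∘ hA'.eigenvalues) = diagonal hA'.eigenvalues := rfl
  rw [h4] at h3
  calc Uᵀ * A * U = Uᵀ * (U * diagonal hA'.eigenvalues * Uᵀ) * U := by rw [← h3]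
    _ = (Uᵀ * U) * diagonal hA'.eigenvalues * (Uᵀ * U) := by simp only [Matrix.mul_assoc]
    _ = _ := by rw [h2, Matrix.one_mul, Matrix.mul_one]

/-- Lu's commutator estimate for a symmetric matrix against an orthogonal family. -/
theorem sum_frobSq_commutator_le {n : ℕ} {κ : Type*} {A : Matrix (Fin n) (Fin n) ℝ}
    (hA : A.IsSymm) (B : κ → Matrix (Fin n) (Fin n) ℝ) (s : Finset κ)
    (hB : ∀ β ∈ s, (B β).IsSymm)
    (ho : ∀ β ∈ s, ∀ γ ∈ s, β ≠ γ → frobInner (B β) (B γ) = 0) {K : ℝ} (hK : 0 ≤ K)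
    (hBK : ∀ β ∈ s, frobSq (B β) ≤ K) :
    ∑ β ∈ s, frobSq (A * B β - B β * A) ≤ frobSq A * (∑ β ∈ s, frobSq (B β) + K) := by
  obtain ⟨U, η, h1, h2, h3⟩ := exists_orthogonal_diagonalization hA
  have hconj : ∀ X, frobSq (Uᵀ * X * U) = frobSq X := fun X => by
    rw [← frobInner_self, frobInner_conj h1, frobInner_self]
  -- Conjugation by the eigenvector matrix of A is a Frobenius isometry, and [diag η, B] has entries
  -- (η_i−η_j)B_ij.
  have key := sum_sq_sub_mul_le_of_orthogonal η (fun β => Uᵀ * B β * U) s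
    (fun β hβ => by
      rw [Matrix.IsSymm, Matrix.transpose_mul, Matrix.transpose_mul, (hB β hβ).eq,
        Matrix.transpose_transpose, Matrix.mul_assoc])
    (fun β hβ γ hγ hne => by rw [frobInner_conj h1]; exact ho β hβ γ hγ hne) hK
    (fun β hβ => by rw [hconj]; exact hBK β hβ)
  have hη : ∑ i, η i ^ 2 = frobSq A := by
    rw [← hconj, h3, frobSq]
    refine Finset.sum_congr rfl fun i _ => ?_
    rw [Finset.sum_eq_single i (fun j _ hj => by simp [Matrix.diagonal_apply_ne _ hj.symm])
      (by simp), Matrix.diagonal_apply_eq]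
  have hc : ∀ β, frobSq (A * B β - B β * A)
      = ∑ i, ∑ j, ((η i - η j) * (Uᵀ * B β * U) i j) ^ 2 := by
    intro β
    have : Uᵀ * (A * B β - B β * A) * U
        = diagonal η * (Uᵀ * B β * U) - (Uᵀ * B β * U) * diagonal η := by
      rw [← h3]
      have e1 : Uᵀ * A * U * (Uᵀ * B β * U) = Uᵀ * (A * ((U * Uᵀ) * B β)) * U := by
        simp only [Matrix.mul_assoc]
      have e2 : Uᵀ * B β * U * (Uᵀ * A * U) = Uᵀ * (B β * ((U * Uᵀ) * A)) * U := by
        simp only [Matrix.mul_assoc]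
      rw [e1, e2, h1, Matrix.one_mul, Matrix.one_mul, Matrix.mul_sub, Matrix.sub_mul]
    rw [← hconj, this, frobSq]
    refine Finset.sum_congr rfl fun i _ => Finset.sum_congr rfl fun j _ => ?_
    rw [Matrix.sub_apply, Matrix.diagonal_mul, Matrix.mul_diagonal]
    ring
  simp_rw [hc]
  rw [hη] at key
  simpa only [hconj] using key

theorem frobSq_commutator_symm {n : ℕ} (A B : Matrix (Fin n) (Fin n) ℝ) :
    frobSq (A * B - B * A) = frobSq (B * A - A * B) := by
  simp only [frobSq, Matrix.sub_apply]
  exact Finset.sum_congr rfl fun i _ => Finset.sum_congr rfl fun j _ => by ring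

/-- Induction on the family, the largest matrix being added last. If A is the new matrix and T, b
are the sum and the maximum of the earlier squared norms, the new commutators contribute at most
2|A|²(T + b). The correction term is chosen so that the step reduces to (|A|² − b)(T − b) ≥ 0. -/
theorem sum_frobSq_commutator_add_le_of_orthogonal {n : ℕ} {κ : Type*} [DecidableEq κ]
    (B : κ → Matrix (Fin n) (Fin n) ℝ) (hB : ∀ β, (B β).IsSymm)
    (ho : ∀ β γ, β ≠ γ → frobInner (B β) (B γ) = 0) (s : Finset κ) :
    ∀ a ∈ s, (∀ β ∈ s, frobSq (B β) ≤ frobSq (B a)) →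
    ∑ α ∈ s, ∑ β ∈ s, frobSq (B α * B β - B β * B α) + ∑ α ∈ s, frobSq (B α) ^ 2
      ≤ (∑ α ∈ s, frobSq (B α)) ^ 2
        + 2 * frobSq (B a) * (∑ α ∈ s, frobSq (B α) - frobSq (B a)) := by
  refine Finset.induction_on_max_value (fun β => frobSq (B β)) s (by simp) ?_
  intro a s has hmax ih a₀ ha₀ hmax₀
  -- The given maximiser may differ from the matrix just added, but their norms agree.
  have hS : frobSq (B a₀) = frobSq (B a) := by
    refine le_antisymm ?_ (hmax₀ a (Finset.mem_insert_self a s))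
    rcases Finset.mem_insert.1 ha₀ with h | h
    · rw [h]
    · exact hmax _ h
  rw [hS]
  simp_rw [Finset.sum_insert has]
  rw [Finset.sum_add_distrib, sub_self]
  have h0 : frobSq (0 : Matrix (Fin n) (Fin n) ℝ) = 0 := by simp [frobSq]
  have hsym : ∑ α ∈ s, frobSq (B α * B a - B a * B α)
      = ∑ α ∈ s, frobSq (B a * B α - B α * B a) :=
    Finset.sum_congr rfl fun α _ => frobSq_commutator_symm _ _
  rw [hsym, h0]
  rcases s.eq_empty_or_nonempty with rfl | hne
  · simp
  obtain ⟨b, hb, hbmax⟩ := Finset.exists_max_image s (fun β => frobSq (B β)) hne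
  have h1 := ih b hb hbmax
  have h2 := sum_frobSq_commutator_le (hB a) B s (fun β _ => hB β)
    (fun β _ γ _ hne => ho β γ hne) (frobSq_nonneg (B b)) hbmax
  have h3 : frobSq (B b) ≤ ∑ α ∈ s, frobSq (B α) :=
    Finset.single_le_sum (f := fun α => frobSq (B α)) (fun α _ => frobSq_nonneg _) hb
  have h4 := mul_le_mul_of_nonneg_right (hmax b hb) (sub_nonneg.2 h3)
  nlinarith

theorem sum_sq_rotate {m : ℕ} {U : Matrix (Fin m) (Fin m) ℝ} (hU : U * Uᵀ = 1)
    (x : Fin m → ℝ) : ∑ α, (∑ β, U β α * x β) ^ 2 = ∑ α, x α ^ 2 := by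
  have h1 : ∀ α, ∑ β, U β α * x β = (Uᵀ *ᵥ x) α := fun α => rfl
  simp_rw [h1, sq]
  change (Uᵀ *ᵥ x) ⬝ᵥ (Uᵀ *ᵥ x) = x ⬝ᵥ x
  rw [Matrix.dotProduct_mulVec, Matrix.vecMul_transpose, Matrix.mulVec_mulVec, hU,
    Matrix.one_mulVec]

/-- The array T(B_α,B_β) becomes UᵀTU, and its Frobenius norm is preserved one index at a time. -/
theorem sum_sum_sq_rotate {m : ℕ} {V : Type*} [AddCommGroup V] [Module ℝ V]
    {U : Matrix (Fin m) (Fin m) ℝ} (hU : U * Uᵀ = 1) (T : V →ₗ[ℝ] V →ₗ[ℝ] ℝ) (B : Fin m → V) :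
    ∑ α, ∑ β, T (∑ γ, U γ α • B γ) (∑ γ, U γ β • B γ) ^ 2 = ∑ α, ∑ β, T (B α) (B β) ^ 2 := by
  have h1 : ∀ α, ∑ β, T (∑ γ, U γ α • B γ) (∑ γ, U γ β • B γ) ^ 2
      = ∑ β, T (∑ γ, U γ α • B γ) (B β) ^ 2 := by
    intro α
    rw [← sum_sq_rotate hU fun β => T (∑ γ, U γ α • B γ) (B β)]
    simp only [map_sum _ (fun γ => U γ _ • B γ), map_smul, smul_eq_mul]
  simp_rw [h1]
  rw [Finset.sum_comm]
  conv_rhs => rw [Finset.sum_comm]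
  refine Finset.sum_congr rfl fun β _ => ?_
  rw [← sum_sq_rotate hU fun α => T (B α) (B β)]
  simp only [map_sum, map_smul, smul_eq_mul, LinearMap.sum_apply, LinearMap.smul_apply]

/-- The Frobenius inner product as a bilinear map. -/
def frobInnerₗ (n : ℕ) :
    Matrix (Fin n) (Fin n) ℝ →ₗ[ℝ] Matrix (Fin n) (Fin n) ℝ →ₗ[ℝ] ℝ :=
  LinearMap.mk₂ ℝ frobInner
    (fun A A' B => by simp [frobInner, add_mul, Finset.sum_add_distrib])
    (fun c A B => by simp [frobInner, mul_assoc, Finset.mul_sum])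
    (fun A B B' => by simp [frobInner, mul_add, Finset.sum_add_distrib])
    (fun c A B => by simp [frobInner, mul_left_comm, Finset.mul_sum])

/-- An entry of the commutator as a bilinear map. -/
def commutatorEntryₗ {n : ℕ} (i j : Fin n) :
    Matrix (Fin n) (Fin n) ℝ →ₗ[ℝ] Matrix (Fin n) (Fin n) ℝ →ₗ[ℝ] ℝ :=
  LinearMap.mk₂ ℝ (fun A B => (A * B - B * A) i j)
    (fun A A' B => by simp only [add_mul, mul_add, Matrix.sub_apply, Matrix.add_apply]; ring)
    (fun c A B => by simp [mul_sub])
    (fun A B B' => by simp only [add_mul, mul_add, Matrix.sub_apply, Matrix.add_apply]; ring)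
    (fun c A B => by simp [mul_sub])

theorem sum_rotate₃ {α β γ : Type*} [Fintype α] [Fintype β] [Fintype γ] (f : α → β → γ → ℝ) :
    ∑ a, ∑ b, ∑ c, f a b c = ∑ c, ∑ a, ∑ b, f a b c := by
  simp_rw [Finset.sum_comm (s := (univ : Finset β)) (t := (univ : Finset γ))]
  rw [Finset.sum_comm]

/-- The inequality of Li and Li. -/
theorem sum_frobSq_commutator_add_le {n m : ℕ} (B : Fin m → Matrix (Fin n) (Fin n) ℝ)
    (hB : ∀ β, (B β).IsSymm) :
    ∑ α, ∑ β, frobSq (B α * B β - B β * B α) + ∑ α, ∑ β, frobInner (B α) (B β) ^ 2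
      ≤ 3 / 2 * (∑ α, frobSq (B α)) ^ 2 := by
  classical
  -- Diagonalising the Gram matrix of the family gives a rotation to a Frobenius orthogonal family
  -- C; all three sums in the inequality are invariant under it.
  obtain ⟨U, η, h1, h2, h3⟩ := exists_orthogonal_diagonalization
    (A := Matrix.of fun α β => frobInner (B α) (B β))
    (by ext α β; simp [frobInner, mul_comm])
  set C : Fin m → Matrix (Fin n) (Fin n) ℝ := fun α => ∑ γ, U γ α • B γ with hC
  have hCsymm : ∀ α, (C α).IsSymm := by
    intro α
    simp only [hC, Matrix.IsSymm, Matrix.transpose_sum, Matrix.transpose_smul, (hB _).eq]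
  have hCinner : ∀ α β, frobInner (C α) (C β) = diagonal η α β := by
    intro α β
    rw [← h3]
    change frobInnerₗ n (C α) (C β) = _
    simp only [hC, map_sum, map_smul, LinearMap.sum_apply, LinearMap.smul_apply, smul_eq_mul,
      Matrix.mul_apply, Matrix.transpose_apply, Matrix.of_apply, Finset.sum_mul, Finset.mul_sum]
    refine Finset.sum_congr rfl fun γ _ => Finset.sum_congr rfl fun δ _ => ?_
    change _ * (_ * frobInner _ _) = _
    ring
  have hrot : ∑ α, ∑ β, frobInner (C α) (C β) ^ 2 = ∑ α, ∑ β, frobInner (B α) (B β) ^ 2 :=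
    sum_sum_sq_rotate h1 (frobInnerₗ n) B
  have hcomm : ∑ α, ∑ β, frobSq (C α * C β - C β * C α)
      = ∑ α, ∑ β, frobSq (B α * B β - B β * B α) := by
    -- Each entry of a commutator is bilinear in the two matrices, so rotation invariance applies
    -- entry by entry.
    have key : ∀ D : Fin m → Matrix (Fin n) (Fin n) ℝ,
        ∑ α, ∑ β, frobSq (D α * D β - D β * D α)
        = ∑ i, ∑ j, ∑ α, ∑ β, commutatorEntryₗ i j (D α) (D β) ^ 2 := by
      intro D
      simp only [frobSq]
      rw [sum_rotate₃]
      exact Finset.sum_congr rfl fun i _ => sum_rotate₃ _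
    rw [key, key]
    exact Finset.sum_congr rfl fun i _ => Finset.sum_congr rfl fun j _ =>
      sum_sum_sq_rotate h1 (commutatorEntryₗ i j) B
  have htr : ∑ α, frobSq (C α) = ∑ α, frobSq (B α) := by
    have key : ∀ D : Fin m → Matrix (Fin n) (Fin n) ℝ,
        ∑ α, frobSq (D α) = ∑ i, ∑ j, ∑ α, D α i j ^ 2 := by
      intro D
      simp only [frobSq]
      rw [← sum_rotate₃]
    rw [key, key]
    refine Finset.sum_congr rfl fun i _ => Finset.sum_congr rfl fun j _ => ?_
    rw [← sum_sq_rotate h1 fun α => B α i j]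
    simp [hC, Matrix.sum_apply]
  have hdiag : ∑ α, ∑ β, frobInner (C α) (C β) ^ 2 = ∑ α, frobSq (C α) ^ 2 := by
    refine Finset.sum_congr rfl fun α _ => ?_
    rw [Finset.sum_eq_single α (fun β _ hβ => by
      rw [hCinner, Matrix.diagonal_apply_ne _ hβ.symm, zero_pow two_ne_zero]) (by simp),
      frobInner_self]
  rw [← hcomm, ← hrot, ← htr, hdiag]
  rcases (univ : Finset (Fin m)).eq_empty_or_nonempty with he | hne
  · simp [he]
  obtain ⟨a, ha, hmax⟩ := Finset.exists_max_image univ (fun β => frobSq (C β)) hne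
  have h5 := sum_frobSq_commutator_add_le_of_orthogonal C hCsymm
    (fun β γ hne => by rw [hCinner, Matrix.diagonal_apply_ne _ hne]) univ a ha hmax
  -- With b the largest squared norm, (3/2)T² − (T² + 2b(T−b)) = (T−2b)²/2.
  nlinarith [sq_nonneg (∑ α, frobSq (C α) - 2 * frobSq (C a))]

/-- Cauchy–Schwarz over the m indices, after keeping only the terms α = β on the right. -/
theorem sq_sum_frobSq_le_card {n m : ℕ} (B : Fin m → Matrix (Fin n) (Fin n) ℝ) :
    (∑ α, frobSq (B α)) ^ 2 ≤ m * ∑ α, ∑ β, frobInner (B α) (B β) ^ 2 := by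
  refine (sq_sum_le_card_mul_sum_sq (s := univ) (f := fun α => frobSq (B α))).trans ?_
  rw [Finset.card_univ, Fintype.card_fin]
  refine mul_le_mul_of_nonneg_left (Finset.sum_le_sum fun α _ => ?_) (Nat.cast_nonneg _)
  rw [← frobInner_self]
  exact Finset.single_le_sum (f := fun β => frobInner (B α) (B β) ^ 2)
    (fun β _ => sq_nonneg _) (Finset.mem_univ α)

/-- The matrix coefficients of the orthogonal projection onto the traceless symmetric matrices. -/
def tracelessProj (n : ℕ) (s t : Fin n × Fin n) : ℝ :=
  ((if s.1 = t.1 then 1 else 0) * (if s.2 = t.2 then 1 else 0)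
    + (if s.1 = t.2 then 1 else 0) * (if s.2 = t.1 then 1 else 0)) / 2
    - (if s.1 = s.2 then 1 else 0) * (if t.1 = t.2 then 1 else 0) / n

theorem sum_tracelessProj_mul {n : ℕ} {B : Matrix (Fin n) (Fin n) ℝ} (hB : B.IsSymm)
    (htr : B.trace = 0) (s : Fin n × Fin n) :
    ∑ t, tracelessProj n s t * B t.1 t.2 = B s.1 s.2 := by
  have h1 : ∑ i, B i i = 0 := htr
  simp only [tracelessProj, sub_mul, add_div, add_mul, Fintype.sum_prod_type,
    Finset.sum_add_distrib, Finset.sum_sub_distrib, mul_ite, ite_mul, mul_one, mul_zero, zero_mul,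
    ite_div, zero_div, Finset.sum_ite_eq, Finset.mem_univ, if_true]
  simp [Finset.sum_ite_irrel, ← Finset.mul_sum, h1]
  rw [hB.apply s.1 s.2]
  ring

/-- The squared norm of an orthogonal projection is its rank, here n(n+1)/2 − 1. -/
theorem sum_sum_tracelessProj_sq {n : ℕ} (hn : n ≠ 0) :
    ∑ s, ∑ t, tracelessProj n s t ^ 2 = ((n : ℝ) ^ 2 + n - 2) / 2 := by
  have hn' : (n : ℝ) ≠ 0 := Nat.cast_ne_zero.2 hn
  -- Squaring the three Kronecker products; the cross terms live where all four indices coincide.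
  have h : ∀ s t : Fin n × Fin n, tracelessProj n s t ^ 2
      = (if s.1 = t.1 then (if s.2 = t.2 then 1 else 0) else 0) / 4
        + (if s.1 = t.2 then (if s.2 = t.1 then 1 else 0) else 0) / 4
        + (if s.1 = t.1 then (if s.2 = t.2 then (if s.1 = s.2 then 1 else 0) else 0) else 0) / 2
        - 2 * (if s.1 = t.1 then (if s.2 = t.2 then (if s.1 = s.2 then 1 else 0) else 0) else 0) / n
        + (if s.1 = s.2 then (if t.1 = t.2 then 1 else 0) else 0) / (n : ℝ) ^ 2 := by
    rintro ⟨i, j⟩ ⟨k, l⟩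
    simp only [tracelessProj]
    split_ifs <;> first | (exfalso; omega) | ring
  simp_rw [h, Fintype.sum_prod_type]
  simp only [Finset.sum_add_distrib, Finset.sum_sub_distrib, ← Finset.sum_div, ← Finset.mul_sum]
  simp [Finset.sum_ite_irrel]
  field_simp
  ring

/-- Let Q = Σ B_α ⊗ B_α and let P be the projection onto traceless symmetric matrices. Since P fixes
every B_α, Σ|B_α|² = ⟨P,Q⟩. Cauchy–Schwarz concludes, as |P|² is the dimension and |Q|² =
Σ⟨B_α,B_β⟩². -/
theorem sq_sum_frobSq_le_dim {n m : ℕ} (hn : n ≠ 0) (B : Fin m → Matrix (Fin n) (Fin n) ℝ)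
    (hB : ∀ β, (B β).IsSymm) (htr : ∀ β, (B β).trace = 0) :
    (∑ α, frobSq (B α)) ^ 2
      ≤ ((n : ℝ) ^ 2 + n - 2) / 2 * ∑ α, ∑ β, frobInner (B α) (B β) ^ 2 := by
  set Q : (Fin n × Fin n) × (Fin n × Fin n) → ℝ :=
    fun e => ∑ α, B α e.1.1 e.1.2 * B α e.2.1 e.2.2 with hQ
  have h1 : ∑ α, frobSq (B α) = ∑ e, tracelessProj n e.1 e.2 * Q e := by
    simp only [hQ, Finset.mul_sum]
    rw [Finset.sum_comm]
    refine Finset.sum_congr rfl fun α _ => ?_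
    rw [Fintype.sum_prod_type]
    have : frobSq (B α) = ∑ s : Fin n × Fin n, B α s.1 s.2 ^ 2 := by
      rw [Fintype.sum_prod_type, frobSq]
    rw [this]
    refine Finset.sum_congr rfl fun s _ => ?_
    rw [sq]
    nth_rw 2 [← sum_tracelessProj_mul (hB α) (htr α) s]
    rw [Finset.mul_sum]
    exact Finset.sum_congr rfl fun t _ => by ring
  have h2 : ∑ e, Q e ^ 2 = ∑ α, ∑ β, frobInner (B α) (B β) ^ 2 := by
    have h3 : ∀ α β, frobInner (B α) (B β) = ∑ s : Fin n × Fin n, B α s.1 s.2 * B β s.1 s.2 := by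
      intro α β
      rw [Fintype.sum_prod_type, frobInner]
    simp only [h3, hQ, sq, Finset.sum_mul_sum]
    refine (sum_rotate₃ _).symm.trans ?_
    refine Finset.sum_congr rfl fun α _ => Finset.sum_congr rfl fun β _ => ?_
    rw [Fintype.sum_prod_type]
    exact Finset.sum_congr rfl fun s _ => Finset.sum_congr rfl fun t _ => by ring
  rw [h1, ← h2, ← sum_sum_tracelessProj_sq hn, ← Fintype.sum_prod_type']
  exact Finset.sum_mul_sq_le_sq_mul_sq _ _ _

/-- The hypothesis improves 3/2 to 3/2 − 1/d in the bound for the commutators. The stated constant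
then works because (2d−1)(3d−2) ≤ 2d(3d−3) amounts to d ≥ 2. -/
theorem sqrt_mul_sqrt_sum_frobSq_commutator_le {n m : ℕ} (B : Fin m → Matrix (Fin n) (Fin n) ℝ)
    (hB : ∀ β, (B β).IsSymm) {d : ℝ} (hd : 2 ≤ d)
    (h : (∑ α, frobSq (B α)) ^ 2 ≤ d * ∑ α, ∑ β, frobInner (B α) (B β) ^ 2) :
    √((2 * d - 1) / (3 * d - 3)) * √(∑ α, ∑ β, frobSq (B α * B β - B β * B α))
      ≤ ∑ α, frobSq (B α) := by
  have h1 := sum_frobSq_commutator_add_le B hB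
  set T := ∑ α, frobSq (B α)
  set X := ∑ α, ∑ β, frobSq (B α * B β - B β * B α)
  set S := ∑ α, ∑ β, frobInner (B α) (B β) ^ 2
  have hT : 0 ≤ T := Finset.sum_nonneg fun _ _ => frobSq_nonneg _
  have hX : 0 ≤ X := Finset.sum_nonneg fun _ _ => Finset.sum_nonneg fun _ _ => frobSq_nonneg _
  have hpos : 0 < 3 * d - 3 := by linarith
  rw [← Real.sqrt_mul (div_nonneg (by linarith) hpos.le)]
  refine Real.sqrt_le_iff.2 ⟨hT, ?_⟩
  rw [div_mul_eq_mul_div, div_le_iff₀ hpos]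
  have h2 : d * X ≤ (3 / 2 * d - 1) * T ^ 2 := by nlinarith
  refine le_of_mul_le_mul_left ?_ (by linarith : 0 < d)
  have h3 := mul_le_mul_of_nonneg_left h2 (by linarith : 0 ≤ 2 * d - 1)
  nlinarith [mul_nonneg (by linarith : 0 ≤ d - 2) (sq_nonneg T)]

theorem normal_scalar_matrix_inequality_codim {n m : ℕ} (hm : 2 ≤ m)
    (B : Fin m → Matrix (Fin n) (Fin n) ℝ) (hB : ∀ β, (B β).IsSymm) :
    √((2 * (m : ℝ) - 1) / (3 * (m : ℝ) - 3))
      * √(∑ α, ∑ β, frobSq (B α * B β - B β * B α)) ≤ ∑ α, frobSq (B α) :=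
  sqrt_mul_sqrt_sum_frobSq_commutator_le B hB (by exact_mod_cast hm) (sq_sum_frobSq_le_card B)

theorem normal_scalar_matrix_inequality_dim {n m : ℕ} (hn : 2 ≤ n)
    (B : Fin m → Matrix (Fin n) (Fin n) ℝ) (hB : ∀ β, (B β).IsSymm)
    (htr : ∀ β, (B β).trace = 0) :
    √((2 / 3) * (((n : ℝ) ^ 2 + (n : ℝ) - 3) / ((n : ℝ) ^ 2 + (n : ℝ) - 4)))
      * √(∑ α, ∑ β, frobSq (B α * B β - B β * B α)) ≤ ∑ α, frobSq (B α) := by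
  have hn' : (2 : ℝ) ≤ n := by exact_mod_cast hn
  -- The constant (2d−1)/(3d−3) at d = (n²+n−2)/2; n ≥ 2 ensures d ≥ 2.
  have h1 : (2 / 3) * (((n : ℝ) ^ 2 + (n : ℝ) - 3) / ((n : ℝ) ^ 2 + (n : ℝ) - 4))
      = (2 * (((n : ℝ) ^ 2 + n - 2) / 2) - 1) / (3 * (((n : ℝ) ^ 2 + n - 2) / 2) - 3) := by
    have h2 : (n : ℝ) ^ 2 + (n : ℝ) - 4 ≠ 0 := by nlinarith
    have h3 : 3 * (((n : ℝ) ^ 2 + n - 2) / 2) - 3 ≠ 0 := by nlinarith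
    rw [div_mul_div_comm, div_eq_div_iff (mul_ne_zero three_ne_zero h2) h3]
    ring
  rw [h1]
  exact sqrt_mul_sqrt_sum_frobSq_commutator_le B hB (by nlinarith)
    (sq_sum_frobSq_le_dim (by omega) B hB htr)

end MatrixInequality

/-! ### Connections along maps in normed spaces; the Gauss and Ricci equations. -/

section AbstractConnection

open Filter Topology

variable {E E' : Type*} [NormedAddCommGroup E] [NormedSpace ℝ E]
  [NormedAddCommGroup E'] [NormedSpace ℝ E']

/-- The covariant derivative along `F` of the field `W`, for a connection with (bundled)
Christoffel symbol `Γ`. -/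
def covAlong (Γ : E' → E' →L[ℝ] E' →L[ℝ] E') (F W : E → E') (x u : E) : E' :=
  fderiv ℝ W x u + Γ (F x) (fderiv ℝ F x u) (W x)

/-- The curvature of the connection with Christoffel symbol `Γ`. -/
def curvOf (Γ : E' → E' →L[ℝ] E' →L[ℝ] E') (y a b w : E') : E' :=
  fderiv ℝ Γ y a b w - fderiv ℝ Γ y b a w + Γ y a (Γ y b w) - Γ y b (Γ y a w)

theorem covAlong_add {Γ : E' → E' →L[ℝ] E' →L[ℝ] E'} {F W W' : E → E'} {x : E}
    (hW : DifferentiableAt ℝ W x) (hW' : DifferentiableAt ℝ W' x) (u : E) :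
    covAlong Γ F (fun y => W y + W' y) x u = covAlong Γ F W x u + covAlong Γ F W' x u := by
  simp only [covAlong]
  rw [fderiv_fun_add hW hW', add_apply, map_add]
  abel

theorem covAlong_congr {Γ : E' → E' →L[ℝ] E' →L[ℝ] E'} {F W W' : E → E'} {x : E}
    (h : W =ᶠ[𝓝 x] W') (u : E) : covAlong Γ F W x u = covAlong Γ F W' x u := by
  simp only [covAlong]
  rw [h.fderiv_eq, h.self_of_nhds]

theorem fderiv_clm_apply_apply {A B C : Type*} [NormedAddCommGroup A] [NormedSpace ℝ A]
    [NormedAddCommGroup B] [NormedSpace ℝ B] [NormedAddCommGroup C] [NormedSpace ℝ C]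
    {P : E → A →L[ℝ] B →L[ℝ] C} {V : E → A} {W : E → B} {x : E} (hP : DifferentiableAt ℝ P x)
    (hV : DifferentiableAt ℝ V x) (hW : DifferentiableAt ℝ W x) (u : E) :
    fderiv ℝ (fun y => P y (V y) (W y)) x u
      = fderiv ℝ P x u (V x) (W x) + P x (fderiv ℝ V x u) (W x) + P x (V x) (fderiv ℝ W x u) := by
  rw [fderiv_clm_apply (hP.clm_apply hV) hW, fderiv_clm_apply hP hV]
  simp
  abel

theorem fderiv_fderiv_apply {F : E → E'} {x : E} (hF : DifferentiableAt ℝ (fderiv ℝ F) x)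
    (u v : E) : fderiv ℝ (fun y => fderiv ℝ F y v) x u = fderiv ℝ (fderiv ℝ F) x u v := by
  rw [fderiv_clm_apply hF (differentiableAt_const v)]
  simp

theorem fderiv_fderiv_comm {F : E → E'} {x : E} (hF : ContDiffAt ℝ ∞ F x) (u v : E) :
    fderiv ℝ (fderiv ℝ F) x u v = fderiv ℝ (fderiv ℝ F) x v u :=
  (hF.isSymmSndFDerivAt (by
    rw [minSmoothness_of_isRCLikeNormedField]
    exact WithTop.coe_le_coe.2 (le_top : (2 : ℕ∞) ≤ ⊤))).eq u v

theorem _root_.ContDiffAt.fderiv_infty {F : E → E'} {x : E} (hF : ContDiffAt ℝ ∞ F x) :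
    ContDiffAt ℝ ∞ (fderiv ℝ F) x :=
  hF.fderiv_right (m := ∞) (by simp)

theorem _root_.ContDiffAt.differentiableAt_infty {F : E → E'} {x : E} (hF : ContDiffAt ℝ ∞ F x) :
    DifferentiableAt ℝ F x :=
  hF.differentiableAt (by simp)

/-- `Γ` is the Christoffel symbol of the Levi-Civita connection of the metric `𝒢` on `U`. -/
structure IsLeviCivita (𝒢 : E → E →L[ℝ] E →L[ℝ] ℝ) (Γ : E → E →L[ℝ] E →L[ℝ] E) (U : Set E) :
    Prop where
  isOpen : IsOpen U
  metric_contDiffAt : ∀ y ∈ U, ContDiffAt ℝ ∞ 𝒢 y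
  contDiffAt : ∀ y ∈ U, ContDiffAt ℝ ∞ Γ y
  metric_symm : ∀ y u v, 𝒢 y u v = 𝒢 y v u
  torsion : ∀ y ∈ U, ∀ u v, Γ y u v = Γ y v u
  compat : ∀ y ∈ U, ∀ u v w, fderiv ℝ 𝒢 y u v w = 𝒢 y (Γ y u v) w + 𝒢 y v (Γ y u w)

/-- `F` is a smooth map from the open set `V` to `U`. -/
structure IsSmoothMap (F : E → E') (V : Set E) (U : Set E') : Prop where
  isOpen : IsOpen V
  mapsTo : ∀ x ∈ V, F x ∈ U
  contDiffAt : ∀ x ∈ V, ContDiffAt ℝ ∞ F x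

variable {𝒢 : E' → E' →L[ℝ] E' →L[ℝ] ℝ} {Γ : E' → E' →L[ℝ] E' →L[ℝ] E'} {U : Set E'}
  {F : E → E'} {V : Set E} {x : E}

theorem IsLeviCivita.fderiv_metric (hΓ : IsLeviCivita 𝒢 Γ U) (hF : IsSmoothMap F V U)
    (hx : x ∈ V) {X Y : E → E'} (hX : DifferentiableAt ℝ X x) (hY : DifferentiableAt ℝ Y x)
    (u : E) : fderiv ℝ (fun y => 𝒢 (F y) (X y) (Y y)) x u
      = 𝒢 (F x) (covAlong Γ F X x u) (Y x) + 𝒢 (F x) (X x) (covAlong Γ F Y x u) := by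
  have hF1 := (hF.contDiffAt x hx).differentiableAt_infty
  have hG := (hΓ.metric_contDiffAt _ (hF.mapsTo x hx)).differentiableAt_infty
  rw [fderiv_clm_apply_apply (P := fun y => 𝒢 (F y)) (hG.comp x hF1) hX hY u]
  have : fderiv ℝ (fun y => 𝒢 (F y)) x u = fderiv ℝ 𝒢 (F x) (fderiv ℝ F x u) := by
    have := fderiv_comp x hG hF1
    rw [Function.comp_def] at this
    rw [this]; rfl
  rw [this, hΓ.compat _ (hF.mapsTo x hx)]
  simp only [covAlong, map_add, add_apply]
  ring

/-- Symmetry of the second derivative of F and vanishing torsion; this is the source of the symmetry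
of the second fundamental form. -/
theorem IsLeviCivita.covAlong_fderiv_comm (hΓ : IsLeviCivita 𝒢 Γ U) (hF : IsSmoothMap F V U)
    (hx : x ∈ V) (u v : E) :
    covAlong Γ F (fun y => fderiv ℝ F y v) x u = covAlong Γ F (fun y => fderiv ℝ F y u) x v := by
  have hF2 := (hF.contDiffAt x hx).fderiv_infty.differentiableAt_infty
  simp only [covAlong]
  rw [fderiv_fderiv_apply hF2, fderiv_fderiv_apply hF2, fderiv_fderiv_comm (hF.contDiffAt x hx),
    hΓ.torsion _ (hF.mapsTo x hx)]

theorem IsLeviCivita.contDiffAt_covAlong (hΓ : IsLeviCivita 𝒢 Γ U) (hF : IsSmoothMap F V U)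
    (hx : x ∈ V) {W : E → E'} (hW : ContDiffAt ℝ ∞ W x) (v : E) :
    ContDiffAt ℝ ∞ (fun y => covAlong Γ F W y v) x := by
  have hF1 := hF.contDiffAt x hx
  have hΓ1 := (hΓ.contDiffAt _ (hF.mapsTo x hx)).comp x hF1
  exact (hW.fderiv_infty.clm_apply contDiffAt_const).add
    ((hΓ1.clm_apply (hF1.fderiv_infty.clm_apply contDiffAt_const)).clm_apply hW)

/-- The commutator of covariant derivatives along a map is the curvature. -/
theorem IsLeviCivita.covAlong_covAlong_sub (hΓ : IsLeviCivita 𝒢 Γ U) (hF : IsSmoothMap F V U)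
    (hx : x ∈ V) {W : E → E'} (hW : ContDiffAt ℝ ∞ W x) (u v : E) :
    covAlong Γ F (fun y => covAlong Γ F W y v) x u - covAlong Γ F (fun y => covAlong Γ F W y u) x v
      = curvOf Γ (F x) (fderiv ℝ F x u) (fderiv ℝ F x v) (W x) := by
  have hF0 := hF.contDiffAt x hx
  have hF1 := hF0.differentiableAt_infty
  have hF2 := hF0.fderiv_infty.differentiableAt_infty
  have hW1 := hW.differentiableAt_infty
  have hW2 := hW.fderiv_infty.differentiableAt_infty
  have hΓ0 := (hΓ.contDiffAt _ (hF.mapsTo x hx)).differentiableAt_infty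
  have hΓ1 : DifferentiableAt ℝ (fun y => Γ (F y)) x := hΓ0.comp x hF1
  have hΓ2 : ∀ u, fderiv ℝ (fun y => Γ (F y)) x u = fderiv ℝ Γ (F x) (fderiv ℝ F x u) := by
    intro u
    have := fderiv_comp x hΓ0 hF1
    rw [Function.comp_def] at this
    rw [this]; rfl
  have key : ∀ u v, fderiv ℝ (fun y => covAlong Γ F W y v) x u
      = fderiv ℝ (fderiv ℝ W) x u v
        + (fderiv ℝ Γ (F x) (fderiv ℝ F x u) (fderiv ℝ F x v) (W x)
          + Γ (F x) (fderiv ℝ (fderiv ℝ F) x u v) (W x)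
          + Γ (F x) (fderiv ℝ F x v) (fderiv ℝ W x u)) := by
    intro u v
    have hFv : DifferentiableAt ℝ (fun y => fderiv ℝ F y v) x :=
      hF2.clm_apply (differentiableAt_const v)
    simp only [covAlong]
    rw [fderiv_fun_add (hW2.clm_apply (differentiableAt_const v))
      ((hΓ1.clm_apply hFv).clm_apply hW1), add_apply,
      fderiv_fderiv_apply hW2, fderiv_clm_apply_apply hΓ1 hFv hW1, hΓ2,
      fderiv_fderiv_apply hF2]
  simp only [covAlong, curvOf] at key ⊢
  rw [key, key, fderiv_fderiv_comm hW u v, fderiv_fderiv_comm hF0 u v]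
  simp only [map_add]
  abel

/-- The second fundamental form, as the part of `∇ᵤ dF(v)` left over by the induced connection
with Christoffel symbol `T`. -/
def secondFormOf (Γ : E' → E' →L[ℝ] E' →L[ℝ] E') (T : E → E →L[ℝ] E →L[ℝ] E) (F : E → E')
    (x u v : E) : E' :=
  covAlong Γ F (fun y => fderiv ℝ F y v) x u - fderiv ℝ F x (T x u v)

/-- `T` is the Christoffel symbol of the connection induced on `V` by the map `F`. -/
structure IsInducedConnection (𝒢 : E' → E' →L[ℝ] E' →L[ℝ] ℝ) (Γ : E' → E' →L[ℝ] E' →L[ℝ] E')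
    (T : E → E →L[ℝ] E →L[ℝ] E) (F : E → E') (V : Set E) : Prop where
  contDiffAt : ∀ x ∈ V, ContDiffAt ℝ ∞ T x
  normal : ∀ x ∈ V, ∀ u v w, 𝒢 (F x) (secondFormOf Γ T F x u v) (fderiv ℝ F x w) = 0

variable {T : E → E →L[ℝ] E →L[ℝ] E}

/-- The Gauss formula for a tangent field with variable coefficients. It holds for every T, since
`secondFormOf` is by definition what T leaves over. -/
theorem covAlong_fderiv_field (hF : IsSmoothMap F V U) (hx : x ∈ V) {Z : E → E}
    (hZ : DifferentiableAt ℝ Z x) (u : E) :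
    covAlong Γ F (fun y => fderiv ℝ F y (Z y)) x u
      = fderiv ℝ F x (fderiv ℝ Z x u + T x u (Z x)) + secondFormOf Γ T F x u (Z x) := by
  have hF2 := (hF.contDiffAt x hx).fderiv_infty.differentiableAt_infty
  simp only [covAlong, secondFormOf]
  rw [fderiv_clm_apply hF2 hZ, fderiv_fderiv_apply hF2]
  simp only [map_add, add_apply, ContinuousLinearMap.comp_apply,
    ContinuousLinearMap.flip_apply]
  abel

/-- The Weingarten formula: differentiate ⟨ξ, dF z⟩ = 0. -/
theorem IsLeviCivita.covAlong_normal (hΓ : IsLeviCivita 𝒢 Γ U) (hF : IsSmoothMap F V U)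
    (hx : x ∈ V) {ξ : E → E'}
    (hξ : DifferentiableAt ℝ ξ x) (hn : ∀ y ∈ V, ∀ z, 𝒢 (F y) (ξ y) (fderiv ℝ F y z) = 0)
    (u z : E) : 𝒢 (F x) (covAlong Γ F ξ x u) (fderiv ℝ F x z)
      = - 𝒢 (F x) (ξ x) (secondFormOf Γ T F x u z) := by
  have hF2 := (hF.contDiffAt x hx).fderiv_infty.differentiableAt_infty
  have h1 := hΓ.fderiv_metric hF hx hξ (hF2.clm_apply (differentiableAt_const z)) u
  have h2 : (fun y => 𝒢 (F y) (ξ y) (fderiv ℝ F y z)) =ᶠ[𝓝 x] fun _ => 0 := by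
    filter_upwards [hF.isOpen.mem_nhds hx] with y hy using hn y hy z
  rw [h2.fderiv_eq] at h1
  have h3 : covAlong Γ F (fun y => fderiv ℝ F y z) x u
      = fderiv ℝ F x (T x u z) + secondFormOf Γ T F x u z := by
    simp only [secondFormOf]; abel
  rw [h3, map_add, hn x hx] at h1
  simp at h1
  linarith

theorem IsLeviCivita.contDiffAt_secondFormOf (hΓ : IsLeviCivita 𝒢 Γ U) (hF : IsSmoothMap F V U)
    (hT : IsInducedConnection 𝒢 Γ T F V) (hx : x ∈ V) (u v : E) :
    ContDiffAt ℝ ∞ (fun y => secondFormOf Γ T F y u v) x := by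
  have hF2 := (hF.contDiffAt x hx).fderiv_infty
  exact (hΓ.contDiffAt_covAlong hF hx (hF2.clm_apply contDiffAt_const) u).sub
    (hF2.clm_apply (((hT.contDiffAt x hx).clm_apply contDiffAt_const).clm_apply contDiffAt_const))

/-- The Gauss equation. -/
theorem IsLeviCivita.gauss_equation (hΓ : IsLeviCivita 𝒢 Γ U) (hF : IsSmoothMap F V U)
    (hT : IsInducedConnection 𝒢 Γ T F V) (hx : x ∈ V) (u v w z : E) :
    𝒢 (F x) (curvOf Γ (F x) (fderiv ℝ F x u) (fderiv ℝ F x v) (fderiv ℝ F x w)) (fderiv ℝ F x z)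
      = 𝒢 (F x) (fderiv ℝ F x (curvOf T x u v w)) (fderiv ℝ F x z)
        - 𝒢 (F x) (secondFormOf Γ T F x v w) (secondFormOf Γ T F x u z)
        + 𝒢 (F x) (secondFormOf Γ T F x u w) (secondFormOf Γ T F x v z) := by
  have hF2 := (hF.contDiffAt x hx).fderiv_infty
  have hT1 := (hT.contDiffAt x hx).differentiableAt_infty
  have hTvw : ∀ v, DifferentiableAt ℝ (fun y => T y v w) x := fun v =>
    (hT1.clm_apply (differentiableAt_const v)).clm_apply (differentiableAt_const w)
  have hTd : ∀ u v, fderiv ℝ (fun y => T y v w) x u = fderiv ℝ T x u v w := by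
    intro u v
    rw [fderiv_clm_apply_apply hT1 (differentiableAt_const v) (differentiableAt_const w)]
    simp
  -- Split ∇ᵥdF(w) into dF(T(v,w)) + h(v,w) and differentiate again: the first part produces the
  -- terms of the curvature of T, the second is handled by the Weingarten formula.
  have key : ∀ u v, 𝒢 (F x) (covAlong Γ F
        (fun y => covAlong Γ F (fun y => fderiv ℝ F y w) y v) x u) (fderiv ℝ F x z)
      = 𝒢 (F x) (fderiv ℝ F x (fderiv ℝ T x u v w + T x u (T x v w))) (fderiv ℝ F x z)
        - 𝒢 (F x) (secondFormOf Γ T F x v w) (secondFormOf Γ T F x u z) := by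
    intro u v
    have h1 : covAlong Γ F (fun y => covAlong Γ F (fun y => fderiv ℝ F y w) y v) x u
        = covAlong Γ F (fun y => fderiv ℝ F y (T y v w) + secondFormOf Γ T F y v w) x u := by
      congr 1
      funext y
      simp only [secondFormOf]; abel
    have h2 := hΓ.contDiffAt_secondFormOf hF hT hx v w
    rw [h1, covAlong_add (hF2.differentiableAt_infty.clm_apply (hTvw v))
      h2.differentiableAt_infty, covAlong_fderiv_field (T := T) hF hx (hTvw v), hTd,
      map_add, map_add, add_apply, add_apply,
      hT.normal x hx, hΓ.covAlong_normal (T := T) hF hx h2.differentiableAt_infty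
        (fun y hy z => hT.normal y hy v w z)]
    ring
  rw [← hΓ.covAlong_covAlong_sub hF hx (hF2.clm_apply contDiffAt_const) u v, map_sub,
    sub_apply, key, key]
  simp only [curvOf, map_add, map_sub, add_apply,
    sub_apply]
  ring

/-- The Ricci equation: `N v` and `dF (S v)` are the normal and the tangential part of `∇ᵥξ`. -/
theorem IsLeviCivita.ricci_equation (hΓ : IsLeviCivita 𝒢 Γ U) (hF : IsSmoothMap F V U)
    (hx : x ∈ V) {ξ : E → E'}
    (hξ : ContDiffAt ℝ ∞ ξ x) {N : E → E → E'} {S : E → E → E}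
    (hN : ∀ v, DifferentiableAt ℝ (N v) x) (hS : ∀ v, DifferentiableAt ℝ (S v) x)
    (hNS : ∀ v, ∀ y ∈ V, covAlong Γ F ξ y v = N v y + fderiv ℝ F y (S v y))
    {η : E'} (hη : ∀ z, 𝒢 (F x) (fderiv ℝ F x z) η = 0) (u v : E) :
    𝒢 (F x) (curvOf Γ (F x) (fderiv ℝ F x u) (fderiv ℝ F x v) (ξ x)) η
      = 𝒢 (F x) (covAlong Γ F (N v) x u) η - 𝒢 (F x) (covAlong Γ F (N u) x v) η
        + 𝒢 (F x) (secondFormOf Γ T F x u (S v x)) η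
        - 𝒢 (F x) (secondFormOf Γ T F x v (S u x)) η := by
  have hF2 := (hF.contDiffAt x hx).fderiv_infty
  have key : ∀ u v, 𝒢 (F x) (covAlong Γ F (fun y => covAlong Γ F ξ y v) x u) η
      = 𝒢 (F x) (covAlong Γ F (N v) x u) η + 𝒢 (F x) (secondFormOf Γ T F x u (S v x)) η := by
    intro u v
    have h1 : (fun y => covAlong Γ F ξ y v) =ᶠ[𝓝 x] fun y => N v y + fderiv ℝ F y (S v y) := by
      filter_upwards [hF.isOpen.mem_nhds hx] with y hy using hNS v y hy
    rw [covAlong_congr h1, covAlong_add (hN v) (hF2.differentiableAt_infty.clm_apply (hS v)),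
      covAlong_fderiv_field (T := T) hF hx (hS v), map_add, map_add,
      add_apply, add_apply, hη, zero_add]
  rw [← hΓ.covAlong_covAlong_sub hF hx hξ u v, map_sub, sub_apply, key, key]
  ring

theorem curvOf_antisymm (Γ : E' → E' →L[ℝ] E' →L[ℝ] E') (y a b w : E') :
    curvOf Γ y a b w = - curvOf Γ y b a w := by
  simp only [curvOf]; abel

/-- The symmetry of Γ holds on an open set, hence passes to its derivative; the cyclic sum then
cancels in pairs. -/
theorem IsLeviCivita.curvOf_bianchi (hΓ : IsLeviCivita 𝒢 Γ U) {y : E'} (hy : y ∈ U)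
    (a b w : E') : curvOf Γ y a b w + curvOf Γ y b w a + curvOf Γ y w a b = 0 := by
  have hd : ∀ a b w, fderiv ℝ Γ y a b w = fderiv ℝ Γ y a w b := by
    intro a b w
    have hΓ1 := (hΓ.contDiffAt y hy).differentiableAt_infty
    have h1 : ∀ b w, fderiv ℝ (fun z => Γ z b w) y a = fderiv ℝ Γ y a b w := by
      intro b w
      rw [fderiv_clm_apply_apply hΓ1 (differentiableAt_const b) (differentiableAt_const w)]
      simp
    rw [← h1, ← h1]
    have h2 : (fun z => Γ z b w) =ᶠ[𝓝 y] fun z => Γ z w b := by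
      filter_upwards [hΓ.isOpen.mem_nhds hy] with z hz using hΓ.torsion z hz b w
    rw [h2.fderiv_eq]
  simp only [curvOf]
  rw [hd a b w, hd b w a, hd w a b, hΓ.torsion y hy b w, hΓ.torsion y hy w a, hΓ.torsion y hy a b]
  abel

/-- Differentiate ⟨v,w⟩ twice with v, w constant. Antisymmetrising in the two directions kills the
left side and the mixed terms, and leaves the commutators of covariant derivatives along the
identity map. -/
theorem IsLeviCivita.metric_curvOf_antisymm (hΓ : IsLeviCivita 𝒢 Γ U) {y : E'} (hy : y ∈ U)
    (a b v w : E') : 𝒢 y (curvOf Γ y a b v) w = - 𝒢 y v (curvOf Γ y a b w) := by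
  have hid : IsSmoothMap (fun z : E' => z) U U :=
    ⟨hΓ.isOpen, fun _ h => h, fun _ _ => contDiffAt_id⟩
  have hc : ∀ v b, ContDiffAt ℝ ∞ (fun z => covAlong Γ (fun z : E' => z) (fun _ => v) z b) y :=
    fun v b => hΓ.contDiffAt_covAlong hid hy contDiffAt_const b
  have h1 : ∀ a b, fderiv ℝ (fderiv ℝ (fun z => 𝒢 z v w)) y a b
      = 𝒢 y (covAlong Γ (fun z : E' => z) (fun z => covAlong Γ (fun z : E' => z) (fun _ => v) z b)
          y a) w
        + 𝒢 y (covAlong Γ (fun z : E' => z) (fun _ => v) y b)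
          (covAlong Γ (fun z : E' => z) (fun _ => w) y a)
        + (𝒢 y (covAlong Γ (fun z : E' => z) (fun _ => v) y a)
          (covAlong Γ (fun z : E' => z) (fun _ => w) y b)
        + 𝒢 y v (covAlong Γ (fun z : E' => z)
          (fun z => covAlong Γ (fun z : E' => z) (fun _ => w) z b) y a)) := by
    intro a b
    have h0 : ContDiffAt ℝ ∞ (fun z => 𝒢 z v w) y :=
      ((hΓ.metric_contDiffAt y hy).clm_apply contDiffAt_const).clm_apply contDiffAt_const
    rw [← fderiv_fderiv_apply h0.fderiv_infty.differentiableAt_infty]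
    have h2 : (fun z => fderiv ℝ (fun z => 𝒢 z v w) z b) =ᶠ[𝓝 y] fun z =>
        𝒢 z (covAlong Γ (fun z : E' => z) (fun _ => v) z b) w
          + 𝒢 z v (covAlong Γ (fun z : E' => z) (fun _ => w) z b) := by
      filter_upwards [hΓ.isOpen.mem_nhds hy] with z hz
      exact hΓ.fderiv_metric hid hz (X := fun _ => v) (Y := fun _ => w)
        (differentiableAt_const v) (differentiableAt_const w) b
    have hG := (hΓ.metric_contDiffAt y hy).differentiableAt_infty
    rw [h2.fderiv_eq, fderiv_fun_add
      ((hG.clm_apply (hc v b).differentiableAt_infty).clm_apply (differentiableAt_const w))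
      ((hG.clm_apply (differentiableAt_const v)).clm_apply (hc w b).differentiableAt_infty),
      add_apply]
    rw [hΓ.fderiv_metric hid hy (X := fun z => covAlong Γ (fun z : E' => z) (fun _ => v) z b)
      (Y := fun _ => w) (hc v b).differentiableAt_infty (differentiableAt_const w),
      hΓ.fderiv_metric hid hy (Y := fun z => covAlong Γ (fun z : E' => z) (fun _ => w) z b)
      (X := fun _ => v) (differentiableAt_const v) (hc w b).differentiableAt_infty]
  have h0 : ContDiffAt ℝ ∞ (fun z => 𝒢 z v w) y :=
    ((hΓ.metric_contDiffAt y hy).clm_apply contDiffAt_const).clm_apply contDiffAt_const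
  have h2 := fderiv_fderiv_comm h0 a b
  rw [h1, h1] at h2
  have h3 := fun v => hΓ.covAlong_covAlong_sub hid hy (W := fun _ => v) contDiffAt_const a b
  simp only [fderiv_fun_id, ContinuousLinearMap.id_apply] at h3
  rw [← h3, ← h3, map_sub, map_sub, sub_apply]
  linarith

end AbstractConnection

/-! ### The Koszul formula and the bundled Christoffel symbol. -/

section Koszul

set_option maxSynthPendingDepth 3

variable {E : Type*} [NormedAddCommGroup E] [NormedSpace ℝ E]

/-- The trilinear form of the Koszul formula. -/
def koszulForm (𝒢 : E → E →L[ℝ] E →L[ℝ] ℝ) (x : E) : E →L[ℝ] E →L[ℝ] E →L[ℝ] ℝ :=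
  (1 / 2 : ℝ) • (fderiv ℝ 𝒢 x + ContinuousLinearMap.flipₗᵢ ℝ E E (E →L[ℝ] ℝ) (fderiv ℝ 𝒢 x)
    - (ContinuousLinearMap.flipₗᵢ ℝ E E
        ℝ).toContinuousLinearEquiv.toContinuousLinearMap.comp
      (ContinuousLinearMap.flipₗᵢ ℝ E E (E →L[ℝ] ℝ) (fderiv ℝ 𝒢 x)))

theorem koszulForm_apply (𝒢 : E → E →L[ℝ] E →L[ℝ] ℝ) (x u v w : E) :
    koszulForm 𝒢 x u v w
      = (fderiv ℝ 𝒢 x u v w + fderiv ℝ 𝒢 x v u w - fderiv ℝ 𝒢 x w u v) / 2 := by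
  simp [koszulForm]
  ring

/-- The Christoffel symbol as a bundled bilinear map. -/
def christoffelL (𝒢 : E → E →L[ℝ] E →L[ℝ] ℝ) (x : E) : E →L[ℝ] E →L[ℝ] E :=
  (ContinuousLinearMap.compL ℝ E (E →L[ℝ] ℝ) E
    (ContinuousLinearMap.inverse (𝒢 x))).comp (koszulForm 𝒢 x)

theorem contDiffAt_christoffelL {𝒢 : E → E →L[ℝ] E →L[ℝ] ℝ} {x : E} (h : ContDiffAt ℝ ∞ 𝒢 x)
    (hi : ContDiffAt ℝ ∞ (fun y => ContinuousLinearMap.inverse (𝒢 y)) x) :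
    ContDiffAt ℝ ∞ (christoffelL 𝒢) x := by
  have h1 := h.fderiv_infty
  have h2 : ContDiffAt ℝ ∞
      (fun y => ContinuousLinearMap.flipₗᵢ ℝ E E (E →L[ℝ] ℝ) (fderiv ℝ 𝒢 y)) x :=
    (LinearIsometryEquiv.contDiff _).contDiffAt.comp x h1
  have h3 : ContDiffAt ℝ ∞ (koszulForm 𝒢) x :=
    ((h1.add h2).sub (ContDiffAt.clm_comp (contDiffAt_const (c := (ContinuousLinearMap.flipₗᵢ ℝ E E
      ℝ).toContinuousLinearEquiv.toContinuousLinearMap)) h2)).const_smul (1 / 2 : ℝ)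
  have h4 : ContDiffAt ℝ ∞ (fun y => ContinuousLinearMap.compL ℝ E (E →L[ℝ] ℝ) E
      (ContinuousLinearMap.inverse (𝒢 y))) x :=
    (ContinuousLinearMap.contDiff _).contDiffAt.comp x hi
  exact h4.clm_comp h3

end Koszul

/-! ### The coordinate definitions expressed through bundled connections. -/

section CoordinateGeometry

open Filter Topology

variable {n k : ℕ}

/-- `𝒢` is a smooth Riemannian metric on the open set `U`. -/
structure IsMetricOn (𝒢 : EuclideanSpace ℝ (Fin k) →
    EuclideanSpace ℝ (Fin k) →L[ℝ] EuclideanSpace ℝ (Fin k) →L[ℝ] ℝ)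
    (U : Set (EuclideanSpace ℝ (Fin k))) : Prop where
  isOpen : IsOpen U
  contDiffAt : ∀ x ∈ U, ContDiffAt ℝ ∞ 𝒢 x
  symm : ∀ x u v, 𝒢 x u v = 𝒢 x v u
  pos : ∀ x ∈ U, ∀ v, v ≠ 0 → 0 < 𝒢 x v v

variable {𝒢 : EuclideanSpace ℝ (Fin k) →
    EuclideanSpace ℝ (Fin k) →L[ℝ] EuclideanSpace ℝ (Fin k) →L[ℝ] ℝ}
  {U : Set (EuclideanSpace ℝ (Fin k))} {x : EuclideanSpace ℝ (Fin k)}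

theorem sum_smul_coordVec (v : EuclideanSpace ℝ (Fin k)) : v = ∑ i, v i • coordVec k i := by
  ext j
  simp [coordVec, Pi.single_apply]

theorem IsMetricOn.injective (h : IsMetricOn 𝒢 U) (hx : x ∈ U) : Function.Injective (𝒢 x) := by
  intro a b hab
  by_contra hne
  have := h.pos x hx (a - b) (sub_ne_zero.2 hne)
  have h0 : 𝒢 x (a - b) = 0 := by rw [map_sub, hab, sub_self]
  rw [h0] at this
  exact lt_irrefl _ this

theorem IsMetricOn.isUnit_det_gram (h : IsMetricOn 𝒢 U) (hx : x ∈ U) :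
    IsUnit (gram (fun x u v => 𝒢 x u v) x).det := by
  rw [isUnit_iff_ne_zero]
  intro h0
  obtain ⟨c, hc, hc0⟩ := Matrix.exists_mulVec_eq_zero_iff.2 h0
  refine hc ?_
  -- A null vector of the Gram matrix is orthogonal to all coordinate vectors, hence to everything.
  have h1 : 𝒢 x (WithLp.toLp 2 c) = 𝒢 x 0 := by
    ext w
    rw [sum_smul_coordVec w, map_zero, map_sum]
    refine Finset.sum_eq_zero fun j _ => ?_
    rw [map_smul, h.symm, sum_smul_coordVec (WithLp.toLp 2 c), map_sum]
    have := congrFun hc0 j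
    simp only [Matrix.mulVec, dotProduct, gram, Matrix.of_apply, Pi.zero_apply] at this
    simp only [map_smul, smul_eq_mul]
    rw [← mul_zero (w j), ← this]
    congr 1
    exact Finset.sum_congr rfl fun i _ => mul_comm _ _
  have h2 := h.injective hx h1
  funext i
  exact congrArg (fun v : EuclideanSpace ℝ (Fin k) => v i) h2

theorem IsMetricOn.metric_sharp (h : IsMetricOn 𝒢 U) (hx : x ∈ U)
    (α : EuclideanSpace ℝ (Fin k) →L[ℝ] ℝ) :
    𝒢 x (sharp (fun x u v => 𝒢 x u v) x α) = α := by
  set g := gram (fun x u v => 𝒢 x u v) x with hg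
  have hdet : IsUnit g.det := h.isUnit_det_gram hx
  have h1 : ∀ j, 𝒢 x (sharp (fun x u v => 𝒢 x u v) x α) (coordVec k j) = α (coordVec k j) := by
    intro j
    rw [h.symm, sum_smul_coordVec (sharp (fun x u v => 𝒢 x u v) x α), map_sum]
    have h2 : g.mulVec (g⁻¹.mulVec fun l => α (coordVec k l)) = fun l => α (coordVec k l) := by
      rw [Matrix.mulVec_mulVec, Matrix.mul_nonsing_inv _ hdet, Matrix.one_mulVec]
    refine Eq.trans ?_ (congrFun h2 j)
    simp only [map_smul, smul_eq_mul, Matrix.mulVec, dotProduct, sharp]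
    refine Finset.sum_congr rfl fun i _ => ?_
    rw [mul_comm]
    rfl
  ext w
  rw [sum_smul_coordVec w]
  simp only [map_sum, map_smul, h1]

/-- The musical isomorphism of a metric at a point. -/
def IsMetricOn.flat (h : IsMetricOn 𝒢 U) (hx : x ∈ U) :
    EuclideanSpace ℝ (Fin k) ≃L[ℝ] (EuclideanSpace ℝ (Fin k) →L[ℝ] ℝ) :=
  (LinearEquiv.ofBijective (𝒢 x : EuclideanSpace ℝ (Fin k) →ₗ[ℝ] _)
    ⟨h.injective hx, fun α => ⟨_, h.metric_sharp hx α⟩⟩).toContinuousLinearEquiv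

theorem IsMetricOn.coe_flat (h : IsMetricOn 𝒢 U) (hx : x ∈ U) :
    (h.flat hx : EuclideanSpace ℝ (Fin k) →L[ℝ] (EuclideanSpace ℝ (Fin k) →L[ℝ] ℝ)) = 𝒢 x := by
  ext; rfl

theorem IsMetricOn.metric_inverse (h : IsMetricOn 𝒢 U) (hx : x ∈ U)
    (α : EuclideanSpace ℝ (Fin k) →L[ℝ] ℝ) :
    𝒢 x (ContinuousLinearMap.inverse (𝒢 x) α) = α := by
  have h1 : ContinuousLinearMap.inverse (𝒢 x)
      = ((h.flat hx).symm : (EuclideanSpace ℝ (Fin k) →L[ℝ] ℝ) →L[ℝ] _) := by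
    rw [← h.coe_flat hx, ContinuousLinearMap.inverse_equiv]
  rw [h1]
  exact (h.flat hx).apply_symm_apply α

theorem IsMetricOn.sharp_eq_inverse (h : IsMetricOn 𝒢 U) (hx : x ∈ U)
    (α : EuclideanSpace ℝ (Fin k) →L[ℝ] ℝ) :
    sharp (fun x u v => 𝒢 x u v) x α = ContinuousLinearMap.inverse (𝒢 x) α :=
  h.injective hx ((h.metric_sharp hx α).trans (h.metric_inverse hx α).symm)

theorem IsMetricOn.contDiffAt_inverse (h : IsMetricOn 𝒢 U) (hx : x ∈ U) :
    ContDiffAt ℝ ∞ (fun y => ContinuousLinearMap.inverse (𝒢 y)) x := by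
  have h1 := contDiffAt_map_inverse (n := ∞) (𝕜 := ℝ) (h.flat hx)
  rw [h.coe_flat hx] at h1
  exact h1.comp x (h.contDiffAt x hx)

theorem IsMetricOn.metric_christoffelL (h : IsMetricOn 𝒢 U) (hx : x ∈ U)
    (u v w : EuclideanSpace ℝ (Fin k)) :
    𝒢 x (christoffelL 𝒢 x u v) w
      = (fderiv ℝ 𝒢 x u v w + fderiv ℝ 𝒢 x v u w - fderiv ℝ 𝒢 x w u v) / 2 := by
  rw [← koszulForm_apply]
  exact congrArg (fun α => α w) (h.metric_inverse hx (koszulForm 𝒢 x u v))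

theorem IsMetricOn.fderiv_apply_apply (h : IsMetricOn 𝒢 U) (hx : x ∈ U)
    (u v w : EuclideanSpace ℝ (Fin k)) :
    fderiv ℝ (fun y => 𝒢 y v w) x u = fderiv ℝ 𝒢 x u v w := by
  rw [fderiv_clm_apply_apply (h.contDiffAt x hx).differentiableAt_infty
    (differentiableAt_const v) (differentiableAt_const w)]
  simp

theorem IsMetricOn.christoffel_eq (h : IsMetricOn 𝒢 U) (hx : x ∈ U)
    (u v : EuclideanSpace ℝ (Fin k)) :
    christoffel (fun x u v => 𝒢 x u v) x u v = christoffelL 𝒢 x u v := by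
  have h1 : christoffelL 𝒢 x u v = ContinuousLinearMap.inverse (𝒢 x) (koszulForm 𝒢 x u v) := rfl
  rw [h1, ← h.sharp_eq_inverse hx, christoffel]
  congr 1
  funext w
  rw [koszulForm_apply, h.fderiv_apply_apply hx, h.fderiv_apply_apply hx, h.fderiv_apply_apply hx]

theorem IsMetricOn.contDiffAt_christoffelL (h : IsMetricOn 𝒢 U) (hx : x ∈ U) :
    ContDiffAt ℝ ∞ (christoffelL 𝒢) x :=
  Submfd.contDiffAt_christoffelL (h.contDiffAt x hx) (h.contDiffAt_inverse hx)

theorem IsMetricOn.fderiv_symm (h : IsMetricOn 𝒢 U) (hx : x ∈ U)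
    (u v w : EuclideanSpace ℝ (Fin k)) : fderiv ℝ 𝒢 x u v w = fderiv ℝ 𝒢 x u w v := by
  rw [← h.fderiv_apply_apply hx, ← h.fderiv_apply_apply hx]
  simp_rw [fun y => h.symm y v w]

theorem IsMetricOn.isLeviCivita (h : IsMetricOn 𝒢 U) : IsLeviCivita 𝒢 (christoffelL 𝒢) U where
  isOpen := h.isOpen
  metric_contDiffAt := h.contDiffAt
  contDiffAt _ hy := h.contDiffAt_christoffelL hy
  metric_symm := h.symm
  torsion y hy u v := by
    refine h.injective hy ?_
    ext w
    rw [h.metric_christoffelL hy, h.metric_christoffelL hy, h.fderiv_symm hy w u v]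
    ring
  compat y hy u v w := by
    rw [h.symm y v, h.metric_christoffelL hy, h.metric_christoffelL hy, h.fderiv_symm hy u w v]
    ring

theorem IsMetricOn.coordCurvature_eq (h : IsMetricOn 𝒢 U) (hx : x ∈ U)
    (u v w : EuclideanSpace ℝ (Fin k)) :
    coordCurvature (fun x u v => 𝒢 x u v) x u v w = curvOf (christoffelL 𝒢) x u v w := by
  have h1 : ∀ u v w, fderiv ℝ (fun y => christoffel (fun x u v => 𝒢 x u v) y v w) x u
      = fderiv ℝ (christoffelL 𝒢) x u v w := by
    intro u v w
    have h2 : (fun y => christoffel (fun x u v => 𝒢 x u v) y v w)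
        =ᶠ[𝓝 x] fun y => christoffelL 𝒢 y v w := by
      filter_upwards [h.isOpen.mem_nhds hx] with y hy using h.christoffel_eq hy v w
    rw [h2.fderiv_eq, fderiv_clm_apply_apply (h.contDiffAt_christoffelL hx).differentiableAt_infty
      (differentiableAt_const v) (differentiableAt_const w)]
    simp
  simp only [coordCurvature, curvOf]
  rw [h1, h1]
  simp only [h.christoffel_eq hx]

/-- The bundled metric induced by `F`. -/
def inducedL (𝒢 : EuclideanSpace ℝ (Fin k) →
    EuclideanSpace ℝ (Fin k) →L[ℝ] EuclideanSpace ℝ (Fin k) →L[ℝ] ℝ)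
    (F : EuclideanSpace ℝ (Fin n) → EuclideanSpace ℝ (Fin k)) (x : EuclideanSpace ℝ (Fin n)) :
    EuclideanSpace ℝ (Fin n) →L[ℝ] EuclideanSpace ℝ (Fin n) →L[ℝ] ℝ :=
  (𝒢 (F x)).bilinearComp (fderiv ℝ F x) (fderiv ℝ F x)

variable {F : EuclideanSpace ℝ (Fin n) → EuclideanSpace ℝ (Fin k)}
  {V : Set (EuclideanSpace ℝ (Fin n))} {p : EuclideanSpace ℝ (Fin n)}

/-- The Levi-Civita connection of the induced metric is the tangential part of the ambient one:
expand each term of the Koszul formula by metric compatibility along F and cancel using ∇ᵤdF(v) =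
∇ᵥdF(u). -/
theorem IsMetricOn.metric_christoffelL_induced (h : IsMetricOn 𝒢 U) (hF : IsSmoothMap F V U)
    (hI : IsMetricOn (inducedL 𝒢 F) V) (hp : p ∈ V) (u v w : EuclideanSpace ℝ (Fin n)) :
    inducedL 𝒢 F p (christoffelL (inducedL 𝒢 F) p u v) w
      = 𝒢 (F p) (covAlong (christoffelL 𝒢) F (fun y => fderiv ℝ F y v) p u) (fderiv ℝ F p w) := by
  have hF2 : ∀ v, DifferentiableAt ℝ (fun y => fderiv ℝ F y v) p := fun v =>
    (hF.contDiffAt p hp).fderiv_infty.differentiableAt_infty.clm_apply (differentiableAt_const v)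
  have h1 : ∀ u v w, fderiv ℝ (inducedL 𝒢 F) p u v w
      = 𝒢 (F p) (covAlong (christoffelL 𝒢) F (fun y => fderiv ℝ F y v) p u) (fderiv ℝ F p w)
        + 𝒢 (F p) (fderiv ℝ F p v)
          (covAlong (christoffelL 𝒢) F (fun y => fderiv ℝ F y w) p u) := by
    intro u v w
    rw [← hI.fderiv_apply_apply hp]
    exact h.isLeviCivita.fderiv_metric hF hp (hF2 v) (hF2 w) u
  rw [hI.metric_christoffelL hp, h1, h1, h1, h.isLeviCivita.covAlong_fderiv_comm hF hp v u,
    h.isLeviCivita.covAlong_fderiv_comm hF hp w u, h.isLeviCivita.covAlong_fderiv_comm hF hp w v,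
    h.symm _ (fderiv ℝ F p v), h.symm _ (fderiv ℝ F p u)]
  ring

theorem IsMetricOn.isInducedConnection (h : IsMetricOn 𝒢 U) (hF : IsSmoothMap F V U)
    (hI : IsMetricOn (inducedL 𝒢 F) V) :
    IsInducedConnection 𝒢 (christoffelL 𝒢) (christoffelL (inducedL 𝒢 F)) F V where
  contDiffAt _ hx := hI.contDiffAt_christoffelL hx
  normal x hx u v w := by
    rw [secondFormOf, map_sub, sub_apply, ← h.metric_christoffelL_induced hF hI hx]
    exact sub_self _

/-- The coordinates of the tangential part of a vector along `F`. -/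
def tangentCoord (𝒢 : EuclideanSpace ℝ (Fin k) →
    EuclideanSpace ℝ (Fin k) →L[ℝ] EuclideanSpace ℝ (Fin k) →L[ℝ] ℝ)
    (F : EuclideanSpace ℝ (Fin n) → EuclideanSpace ℝ (Fin k)) (x : EuclideanSpace ℝ (Fin n))
    (W : EuclideanSpace ℝ (Fin k)) : EuclideanSpace ℝ (Fin n) :=
  ContinuousLinearMap.inverse (inducedL 𝒢 F x) ((𝒢 (F x) W).comp (fderiv ℝ F x))

theorem metric_tangentCoord (hI : IsMetricOn (inducedL 𝒢 F) V) (hp : p ∈ V)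
    (W : EuclideanSpace ℝ (Fin k)) (z : EuclideanSpace ℝ (Fin n)) :
    𝒢 (F p) (fderiv ℝ F p (tangentCoord 𝒢 F p W)) (fderiv ℝ F p z)
      = 𝒢 (F p) W (fderiv ℝ F p z) :=
  congrArg (fun α => α z) (hI.metric_inverse hp ((𝒢 (F p) W).comp (fderiv ℝ F p)))

theorem normalPart_eq (hI : IsMetricOn (inducedL 𝒢 F) V) (hp : p ∈ V)
    (W : EuclideanSpace ℝ (Fin k)) :
    normalPart (fun x u v => 𝒢 x u v) F p W = W - fderiv ℝ F p (tangentCoord 𝒢 F p W) := by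
  rw [tangentCoord, ← hI.sharp_eq_inverse hp]
  rfl

theorem metric_normalPart (hI : IsMetricOn (inducedL 𝒢 F) V) (hp : p ∈ V)
    (W : EuclideanSpace ℝ (Fin k)) (z : EuclideanSpace ℝ (Fin n)) :
    𝒢 (F p) (normalPart (fun x u v => 𝒢 x u v) F p W) (fderiv ℝ F p z) = 0 := by
  rw [normalPart_eq hI hp, map_sub, sub_apply, metric_tangentCoord hI hp, sub_self]

theorem contDiffAt_tangentCoord (h : IsMetricOn 𝒢 U) (hF : IsSmoothMap F V U)
    (hI : IsMetricOn (inducedL 𝒢 F) V) (hp : p ∈ V)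
    {W : EuclideanSpace ℝ (Fin n) → EuclideanSpace ℝ (Fin k)} (hW : ContDiffAt ℝ ∞ W p) :
    ContDiffAt ℝ ∞ (fun y => tangentCoord 𝒢 F y (W y)) p := by
  have hF1 := hF.contDiffAt p hp
  have hG := (h.contDiffAt _ (hF.mapsTo p hp)).comp p hF1
  exact (hI.contDiffAt_inverse hp).clm_apply ((hG.clm_apply hW).clm_comp hF1.fderiv_infty)

theorem covDerivAlong_eq (h : IsMetricOn 𝒢 U) (hF : IsSmoothMap F V U) (hp : p ∈ V)
    (W : EuclideanSpace ℝ (Fin n) → EuclideanSpace ℝ (Fin k)) (u : EuclideanSpace ℝ (Fin n)) :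
    covDerivAlong (fun x u v => 𝒢 x u v) F W p u = covAlong (christoffelL 𝒢) F W p u := by
  rw [covDerivAlong, covAlong, h.christoffel_eq (hF.mapsTo p hp)]

theorem coordSecondFundamentalForm_eq (h : IsMetricOn 𝒢 U) (hF : IsSmoothMap F V U)
    (hI : IsMetricOn (inducedL 𝒢 F) V) (hp : p ∈ V) (u v : EuclideanSpace ℝ (Fin n)) :
    coordSecondFundamentalForm (fun x u v => 𝒢 x u v) F p u v
      = secondFormOf (christoffelL 𝒢) (christoffelL (inducedL 𝒢 F)) F p u v := by
  rw [coordSecondFundamentalForm, normalPart_eq hI hp, covDerivAlong_eq h hF hp, secondFormOf]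
  congr 2
  refine hI.injective hp ?_
  ext w
  rw [h.metric_christoffelL_induced hF hI hp]
  exact metric_tangentCoord hI hp _ w

theorem normalPart_of_normal (hI : IsMetricOn (inducedL 𝒢 F) V) (hp : p ∈ V)
    {ξ : EuclideanSpace ℝ (Fin k)} (hξ : ∀ z, 𝒢 (F p) ξ (fderiv ℝ F p z) = 0) :
    normalPart (fun x u v => 𝒢 x u v) F p ξ = ξ := by
  have h1 : (𝒢 (F p) ξ).comp (fderiv ℝ F p) = 0 := by ext z; exact hξ z
  rw [normalPart_eq hI hp, tangentCoord, h1, map_zero, map_zero, sub_zero]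

theorem gauss_equation_coord (h : IsMetricOn 𝒢 U) (hF : IsSmoothMap F V U)
    (hI : IsMetricOn (inducedL 𝒢 F) V) (hp : p ∈ V) (u v w z : EuclideanSpace ℝ (Fin n)) :
    inducedL 𝒢 F p (coordCurvature (inducedMetric (fun x u v => 𝒢 x u v) F) p u v w) z
      = 𝒢 (F p) (curvOf (christoffelL 𝒢) (F p) (fderiv ℝ F p u) (fderiv ℝ F p v)
          (fderiv ℝ F p w)) (fderiv ℝ F p z)
        + 𝒢 (F p) (coordSecondFundamentalForm (fun x u v => 𝒢 x u v) F p v w)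
          (coordSecondFundamentalForm (fun x u v => 𝒢 x u v) F p u z)
        - 𝒢 (F p) (coordSecondFundamentalForm (fun x u v => 𝒢 x u v) F p u w)
          (coordSecondFundamentalForm (fun x u v => 𝒢 x u v) F p v z) := by
  simp only [coordSecondFundamentalForm_eq h hF hI hp]
  have h1 := h.isLeviCivita.gauss_equation hF (h.isInducedConnection hF hI) hp u v w z
  have h2 : coordCurvature (inducedMetric (fun x u v => 𝒢 x u v) F) p u v w
      = curvOf (christoffelL (inducedL 𝒢 F)) p u v w := hI.coordCurvature_eq hp u v w
  rw [h2, h1]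
  change 𝒢 (F p) (fderiv ℝ F p _) (fderiv ℝ F p z) = _
  ring

/-- The Ricci equation; the vectors `S w` are (minus) the values of the shape operator of `ξ`. -/
theorem ricci_equation_coord (h : IsMetricOn 𝒢 U) (hF : IsSmoothMap F V U)
    (hI : IsMetricOn (inducedL 𝒢 F) V) (hp : p ∈ V) {ξ η : EuclideanSpace ℝ (Fin k)}
    (hξ : ∀ z, 𝒢 (F p) ξ (fderiv ℝ F p z) = 0) (hη : ∀ z, 𝒢 (F p) η (fderiv ℝ F p z) = 0) :
    ∃ S : EuclideanSpace ℝ (Fin n) → EuclideanSpace ℝ (Fin n),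
      (∀ w z, inducedL 𝒢 F p (S w) z
        = - 𝒢 (F p) ξ (coordSecondFundamentalForm (fun x u v => 𝒢 x u v) F p w z)) ∧
      ∀ u v, 𝒢 (F p) (coordNormalCurvature (fun x u v => 𝒢 x u v) F p u v ξ) η
        = 𝒢 (F p) (curvOf (christoffelL 𝒢) (F p) (fderiv ℝ F p u) (fderiv ℝ F p v) ξ) η
          - 𝒢 (F p) (coordSecondFundamentalForm (fun x u v => 𝒢 x u v) F p u (S v)) η
          + 𝒢 (F p) (coordSecondFundamentalForm (fun x u v => 𝒢 x u v) F p v (S u)) η := by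
  set G : CoordMetric k := fun x u v => 𝒢 x u v with hG
  -- Projecting the constant vector ξ gives a smooth normal field on V, with value ξ at p.
  set ξ' : EuclideanSpace ℝ (Fin n) → EuclideanSpace ℝ (Fin k) := fun z => normalPart G F z ξ
    with hξ'
  have hξp : ξ' p = ξ := normalPart_of_normal hI hp hξ
  have hsm : ∀ x ∈ V, ∀ {W : EuclideanSpace ℝ (Fin n) → EuclideanSpace ℝ (Fin k)},
      ContDiffAt ℝ ∞ W x → ContDiffAt ℝ ∞ (fun y => normalPart G F y (W y)) x := by
    intro x hx W hW
    have h1 : (fun y => normalPart G F y (W y))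
        =ᶠ[𝓝 x] fun y => W y - fderiv ℝ F y (tangentCoord 𝒢 F y (W y)) := by
      filter_upwards [hF.isOpen.mem_nhds hx] with y hy using normalPart_eq hI hy _
    exact (hW.sub ((hF.contDiffAt x hx).fderiv_infty.clm_apply
      (contDiffAt_tangentCoord h hF hI hx hW))).congr_of_eventuallyEq h1
  have hξs : ∀ x ∈ V, ContDiffAt ℝ ∞ ξ' x := fun x hx => hsm x hx contDiffAt_const
  have hcov : ∀ v, ContDiffAt ℝ ∞ (fun y => covAlong (christoffelL 𝒢) F ξ' y v) p := fun v =>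
    h.isLeviCivita.contDiffAt_covAlong hF hp (hξs p hp) v
  set S : EuclideanSpace ℝ (Fin n) → EuclideanSpace ℝ (Fin n) → EuclideanSpace ℝ (Fin n) :=
    fun v y => tangentCoord 𝒢 F y (covAlong (christoffelL 𝒢) F ξ' y v) with hS
  set N : EuclideanSpace ℝ (Fin n) → EuclideanSpace ℝ (Fin n) → EuclideanSpace ℝ (Fin k) :=
    fun v y => normalPart G F y (covAlong (christoffelL 𝒢) F ξ' y v) with hN
  have hηs : ∀ z, 𝒢 (F p) (fderiv ℝ F p z) η = 0 := fun z => by rw [h.symm, hη]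
  refine ⟨fun v => S v p, fun w z => ?_, fun u v => ?_⟩
  · have h1 := h.isLeviCivita.covAlong_normal (T := christoffelL (inducedL 𝒢 F)) hF hp
      (hξs p hp).differentiableAt_infty (fun y hy z => metric_normalPart hI hy ξ z) w z
    rw [coordSecondFundamentalForm_eq h hF hI hp, ← hξp, ← h1]
    exact metric_tangentCoord hI hp _ z
  · have h1 := h.isLeviCivita.ricci_equation (T := christoffelL (inducedL 𝒢 F)) hF hp (hξs p hp)
      (N := N) (S := S) (fun v => (hsm p hp (hcov v)).differentiableAt_infty)
      (fun v => (contDiffAt_tangentCoord h hF hI hp (hcov v)).differentiableAt_infty)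
      (fun v y hy => by
        simp only [hN, hS, hG]
        rw [normalPart_eq hI hy, sub_add_cancel]) hηs u v
    -- The outer normal projection removes only a tangent vector, which η does not see.
    have h2 : ∀ u v, 𝒢 (F p) (normalDeriv G F (fun y => normalDeriv G F ξ' y v) p u) η
        = 𝒢 (F p) (covAlong (christoffelL 𝒢) F (N v) p u) η := by
      intro u v
      have h3 : (fun y => normalDeriv G F ξ' y v) =ᶠ[𝓝 p] N v := by
        filter_upwards [hF.isOpen.mem_nhds hp] with y hy
        simp only [normalDeriv, hN, hG, covDerivAlong_eq h hF hy]
      rw [normalDeriv, normalPart_eq hI hp, covDerivAlong_eq h hF hp, covAlong_congr h3, map_sub,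
        sub_apply, hηs, sub_zero]
    rw [hξp] at h1
    rw [coordNormalCurvature, map_sub, sub_apply, h2, h2, h1,
      coordSecondFundamentalForm_eq h hF hI hp, coordSecondFundamentalForm_eq h hF hI hp]
    ring

end CoordinateGeometry

/-! ### Immersions in charts. -/

section ChartExpression

variable {n k : ℕ}
  {M : Type*} [TopologicalSpace M] [ChartedSpace (EuclideanSpace ℝ (Fin n)) M]
  {N : Type*} [TopologicalSpace N] [ChartedSpace (EuclideanSpace ℝ (Fin k)) N]

/-- The derivative of the inverse of the chart at `p`. -/
def chartSymmDeriv (n : ℕ) {M : Type*} [TopologicalSpace M]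
    [ChartedSpace (EuclideanSpace ℝ (Fin n)) M] (p : M)
    (x : EuclideanSpace ℝ (Fin n)) : EuclideanSpace ℝ (Fin n) →L[ℝ] EuclideanSpace ℝ (Fin n) :=
  mfderiv 𝓘(ℝ, EuclideanSpace ℝ (Fin n)) (𝓡 n) (extChartAt (𝓡 n) p).symm x

theorem mfderiv_chartSymm_eq (p : M) (x : EuclideanSpace ℝ (Fin n)) :
    chartSymmDeriv n p x = mfderivWithin 𝓘(ℝ, EuclideanSpace ℝ (Fin n)) (𝓡 n)
      (extChartAt (𝓡 n) p).symm (Set.range (𝓡 n)) x := by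
  rw [ModelWithCorners.range_eq_univ, mfderivWithin_univ]
  rfl

/-- The domain of the coordinate expression of `f` at `p`. -/
def chartDomain (n k : ℕ) {M N : Type*} [TopologicalSpace M]
    [ChartedSpace (EuclideanSpace ℝ (Fin n)) M] [TopologicalSpace N]
    [ChartedSpace (EuclideanSpace ℝ (Fin k)) N] (f : M → N) (p : M) :
    Set (EuclideanSpace ℝ (Fin n)) :=
  (extChartAt (𝓡 n) p).target ∩
    (extChartAt (𝓡 n) p).symm ⁻¹' (f ⁻¹' (extChartAt (𝓡 k) (f p)).source)

theorem mem_chartDomain (f : M → N) (p : M) :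
    extChartAt (𝓡 n) p p ∈ chartDomain n k f p :=
  ⟨mem_extChartAt_target p, by simp⟩

theorem written_self (f : M → N) (p : M) :
    writtenInExtChartAt (𝓡 n) (𝓡 k) p f (extChartAt (𝓡 n) p p) = extChartAt (𝓡 k) (f p) (f p) := by
  simp [writtenInExtChartAt]

end ChartExpression

/-! ### Riemannian metrics in charts. -/

section ChartMetric

open Filter Topology

variable {n k : ℕ}
  {M : Type*} [TopologicalSpace M] [ChartedSpace (EuclideanSpace ℝ (Fin n)) M]
  [IsManifold (𝓡 n) ∞ M]
  {N : Type*} [TopologicalSpace N] [ChartedSpace (EuclideanSpace ℝ (Fin k)) N]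
  [IsManifold (𝓡 k) ∞ N]

instance isManifold_one_of_infty : IsManifold (𝓡 n) 1 M :=
  IsManifold.of_le (n := ∞) (WithTop.coe_le_coe.2 (le_top : (1 : ℕ∞) ≤ ⊤))

/-- The metric at a point, as a bilinear form on the model space. -/
def metricAt (g : SmoothMetric n M) (q : M) :
    EuclideanSpace ℝ (Fin n) →L[ℝ] EuclideanSpace ℝ (Fin n) →L[ℝ] ℝ := g.inner q

/-- The bundled expression of the metric in the chart at `p`. -/
def chartMetricL (g : SmoothMetric n M) (p : M) (x : EuclideanSpace ℝ (Fin n)) :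
    EuclideanSpace ℝ (Fin n) →L[ℝ] EuclideanSpace ℝ (Fin n) →L[ℝ] ℝ :=
  (metricAt g ((extChartAt (𝓡 n) p).symm x)).bilinearComp (chartSymmDeriv n p x)
    (chartSymmDeriv n p x)

theorem chartMetricL_apply (g : SmoothMetric n M) (p : M) (x u v : EuclideanSpace ℝ (Fin n)) :
    chartMetricL g p x u v = metricAt g ((extChartAt (𝓡 n) p).symm x) (chartSymmDeriv n p x u)
      (chartSymmDeriv n p x v) := rfl

theorem metricAt_symm (g : SmoothMetric n M) (q : M) (u v : EuclideanSpace ℝ (Fin n)) :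
    metricAt g q u v = metricAt g q v u := g.symm q u v

theorem metricAt_pos (g : SmoothMetric n M) (q : M) {v : EuclideanSpace ℝ (Fin n)} (hv : v ≠ 0) :
    0 < metricAt g q v v := g.pos q v hv

theorem mdifferentiableAt_chartSymm {p : M} {x : EuclideanSpace ℝ (Fin n)}
    (hx : x ∈ (extChartAt (𝓡 n) p).target) :
    MDifferentiableAt 𝓘(ℝ, EuclideanSpace ℝ (Fin n)) (𝓡 n) (extChartAt (𝓡 n) p).symm x := by
  have := mdifferentiableWithinAt_extChartAt_symm hx
  rwa [ModelWithCorners.range_eq_univ, mdifferentiableWithinAt_univ] at this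

theorem chartSymmDeriv_injective {p : M} {x : EuclideanSpace ℝ (Fin n)}
    (hx : x ∈ (extChartAt (𝓡 n) p).target) : Function.Injective (chartSymmDeriv n p x) := by
  rw [mfderiv_chartSymm_eq]
  exact (isInvertible_mfderivWithin_extChartAt_symm hx).injective

/-- At its own base point the preferred chart has identity differential, so that the chart
expression of g there is g itself. -/
theorem chartSymmDeriv_self (p : M) (v : EuclideanSpace ℝ (Fin n)) :
    chartSymmDeriv n p (extChartAt (𝓡 n) p p) v = v := by
  rw [mfderiv_chartSymm_eq]
  exact congrArg (fun L => L v) (mfderivWithin_range_extChartAt_symm (I := 𝓡 n) (x := p))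

theorem chartMetricL_self (g : SmoothMetric n M) (p : M) (v w : EuclideanSpace ℝ (Fin n)) :
    chartMetricL g p (extChartAt (𝓡 n) p p) v w = metricAt g p v w := by
  rw [chartMetricL_apply, extChartAt_to_inv, chartSymmDeriv_self, chartSymmDeriv_self]

/-- Smoothness may be tested on constant vectors. Their images under the tangent map of the inverse
chart are smooth sections along it, and the bundle metric is contracted with them. -/
theorem contDiffOn_chartMetricL (g : SmoothMetric n M) (p : M) :
    ContDiffOn ℝ ∞ (chartMetricL g p) (extChartAt (𝓡 n) p).target := by
  have hopen : IsOpen (extChartAt (𝓡 n) p).target := isOpen_extChartAt_target p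
  have hsymm := contMDiffOn_extChartAt_symm (I := 𝓡 n) (n := ∞) p
  have hvec : ∀ u : EuclideanSpace ℝ (Fin n), ContMDiffOn 𝓘(ℝ, EuclideanSpace ℝ (Fin n))
      ((𝓡 n).prod 𝓘(ℝ, EuclideanSpace ℝ (Fin n))) ∞
      (fun x => (⟨(extChartAt (𝓡 n) p).symm x, chartSymmDeriv n p x u⟩ : TangentBundle (𝓡 n) M))
      (extChartAt (𝓡 n) p).target := by
    intro u
    have h1 := hsymm.contMDiffOn_tangentMapWithin (m := ∞) (by simp) hopen.uniqueMDiffOn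
    have h2 : ContMDiffOn 𝓘(ℝ, EuclideanSpace ℝ (Fin n))
        (𝓘(ℝ, EuclideanSpace ℝ (Fin n)).prod 𝓘(ℝ, EuclideanSpace ℝ (Fin n))) ∞
        (fun x => (⟨x, u⟩ : TangentBundle 𝓘(ℝ, EuclideanSpace ℝ (Fin n))
          (EuclideanSpace ℝ (Fin n)))) (extChartAt (𝓡 n) p).target :=
      contMDiffOn_vectorSpace_iff_contDiffOn.2 contDiffOn_const
    refine (h1.comp h2 (fun x hx => hx)).congr fun x hx => ?_
    simp only [Function.comp_apply, tangentMapWithin, chartSymmDeriv]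
    rw [mfderivWithin_of_isOpen hopen hx]
    rfl
  rw [contDiffOn_clm_apply]
  intro u
  rw [contDiffOn_clm_apply]
  intro v
  have h3 := ContMDiffOn.clm_bundle_apply₂ (F₁ := EuclideanSpace ℝ (Fin n))
    (F₂ := EuclideanSpace ℝ (Fin n)) (F₃ := ℝ) (E₃ := Bundle.Trivial M ℝ)
    (g.contMDiff.comp_contMDiffOn hsymm) (hvec u) (hvec v)
  intro x hx
  have h4 := (Bundle.contMDiffWithinAt_totalSpace.1 (h3 x hx)).2
  exact h4.contDiffWithinAt

theorem isMetricOn_chartMetricL (g : SmoothMetric n M) (p : M) :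
    IsMetricOn (chartMetricL g p) (extChartAt (𝓡 n) p).target where
  isOpen := isOpen_extChartAt_target p
  contDiffAt x hx := (contDiffOn_chartMetricL g p).contDiffAt
    ((isOpen_extChartAt_target p).mem_nhds hx)
  symm x u v := by rw [chartMetricL_apply, chartMetricL_apply, metricAt_symm]
  pos x hx v hv := by
    rw [chartMetricL_apply]
    exact metricAt_pos g _ fun h0 =>
      hv (chartSymmDeriv_injective hx (h0.trans (map_zero (chartSymmDeriv n p x)).symm))

variable {g : SmoothMetric n M} {g' : SmoothMetric k N} {f : M → N}

theorem IsIsometricImmersion.isSmoothMap (hf : IsIsometricImmersion g g' f) (p : M) :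
    IsSmoothMap (writtenInExtChartAt (𝓡 n) (𝓡 k) p f) (chartDomain n k f p)
      (extChartAt (𝓡 k) (f p)).target := by
  have hopen : IsOpen (chartDomain n k f p) :=
    (continuousOn_extChartAt_symm p).isOpen_inter_preimage (isOpen_extChartAt_target p)
      ((isOpen_extChartAt_source (f p)).preimage hf.contMDiff.continuous)
  refine ⟨hopen, fun x hx => (extChartAt (𝓡 k) (f p)).map_source hx.2, fun x hx => ?_⟩
  have h1 : ContMDiffOn 𝓘(ℝ, EuclideanSpace ℝ (Fin n)) 𝓘(ℝ, EuclideanSpace ℝ (Fin k)) ∞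
      (writtenInExtChartAt (𝓡 n) (𝓡 k) p f) (chartDomain n k f p) := by
    refine (contMDiffOn_extChartAt (I := 𝓡 k) (n := ∞) (x := f p)).comp
      (hf.contMDiff.comp_contMDiffOn
        ((contMDiffOn_extChartAt_symm (I := 𝓡 n) (n := ∞) p).mono Set.inter_subset_left)) ?_
    intro y hy
    have := hy.2
    rwa [Set.mem_preimage, Set.mem_preimage, extChartAt_source] at this
  exact h1.contDiffOn.contDiffAt (hopen.mem_nhds hx)

/-- With F the coordinate expression, f ∘ (chart of M)⁻¹ and (chart of N)⁻¹ ∘ F agree near x.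
Differentiate this and use that f is isometric. -/
theorem IsIsometricImmersion.chartMetricL_eq (hf : IsIsometricImmersion g g' f) (p : M)
    {x : EuclideanSpace ℝ (Fin n)} (hx : x ∈ chartDomain n k f p) :
    inducedL (chartMetricL g' (f p)) (writtenInExtChartAt (𝓡 n) (𝓡 k) p f) x
      = chartMetricL g p x := by
  have hF := hf.isSmoothMap p
  set F := writtenInExtChartAt (𝓡 n) (𝓡 k) p f with hFdef
  have hFx : (extChartAt (𝓡 k) (f p)).symm (F x) = f ((extChartAt (𝓡 n) p).symm x) :=
    (extChartAt (𝓡 k) (f p)).left_inv hx.2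
  have hd : ∀ u, chartSymmDeriv k (f p) (F x) (fderiv ℝ F x u)
      = mfderiv (𝓡 n) (𝓡 k) f ((extChartAt (𝓡 n) p).symm x) (chartSymmDeriv n p x u) := by
    intro u
    have h1 : (extChartAt (𝓡 k) (f p)).symm ∘ F =ᶠ[𝓝 x] f ∘ (extChartAt (𝓡 n) p).symm := by
      filter_upwards [hF.isOpen.mem_nhds hx] with y hy
      exact (extChartAt (𝓡 k) (f p)).left_inv hy.2
    have h2 := h1.mfderiv_eq (I := 𝓘(ℝ, EuclideanSpace ℝ (Fin n))) (I' := 𝓡 k)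
    rw [mfderiv_comp x (hf.contMDiff.mdifferentiable (by simp) _)
      (mdifferentiableAt_chartSymm hx.1),
      mfderiv_comp x (mdifferentiableAt_chartSymm (hF.mapsTo x hx))
      (hF.contDiffAt x hx).differentiableAt_infty.mdifferentiableAt, mfderiv_eq_fderiv] at h2
    exact congrArg (fun L => L u) h2
  ext u v
  change metricAt g' _ (chartSymmDeriv k (f p) (F x) (fderiv ℝ F x u))
    (chartSymmDeriv k (f p) (F x) (fderiv ℝ F x v)) = _
  rw [hFx, hd, hd]
  exact hf.isometric _ _ _

theorem IsIsometricImmersion.isMetricOn (hf : IsIsometricImmersion g g' f) (p : M) :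
    IsMetricOn (inducedL (chartMetricL g' (f p)) (writtenInExtChartAt (𝓡 n) (𝓡 k) p f))
      (chartDomain n k f p) where
  isOpen := (hf.isSmoothMap p).isOpen
  contDiffAt x hx := by
    refine ((isMetricOn_chartMetricL g p).contDiffAt x hx.1).congr_of_eventuallyEq ?_
    filter_upwards [(hf.isSmoothMap p).isOpen.mem_nhds hx] with y hy using hf.chartMetricL_eq p hy
  symm x u v := by
    simp only [inducedL, ContinuousLinearMap.bilinearComp_apply]
    exact (isMetricOn_chartMetricL g' (f p)).symm _ _ _
  pos x hx v hv := by
    rw [hf.chartMetricL_eq p hx]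
    exact (isMetricOn_chartMetricL g p).pos x hx.1 v hv

/-- The two metrics agree only on the domain of the coordinate expression, which suffices because
curvature depends on the germ of the metric. -/
theorem IsIsometricImmersion.curvature_eq (hf : IsIsometricImmersion g g' f) (p : M)
    (X Y Z : EuclideanSpace ℝ (Fin n)) :
    curvature g p X Y Z = coordCurvature (inducedMetric (chartMetric g' (f p))
      (writtenInExtChartAt (𝓡 n) (𝓡 k) p f)) (extChartAt (𝓡 n) p p) X Y Z := by
  have hp := mem_chartDomain (n := n) (k := k) f p
  have h1 : chartMetricL g p =ᶠ[𝓝 (extChartAt (𝓡 n) p p)]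
      inducedL (chartMetricL g' (f p)) (writtenInExtChartAt (𝓡 n) (𝓡 k) p f) := by
    filter_upwards [(hf.isSmoothMap p).isOpen.mem_nhds hp] with y hy
    exact (hf.chartMetricL_eq p hy).symm
  have h2 : christoffelL (chartMetricL g p) =ᶠ[𝓝 (extChartAt (𝓡 n) p p)]
      christoffelL (inducedL (chartMetricL g' (f p)) (writtenInExtChartAt (𝓡 n) (𝓡 k) p f)) := by
    filter_upwards [h1, h1.fderiv (𝕜 := ℝ)] with y hy hy'
    simp only [christoffelL, koszulForm, hy, hy']
  have h3 : coordCurvature (inducedMetric (chartMetric g' (f p))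
      (writtenInExtChartAt (𝓡 n) (𝓡 k) p f)) (extChartAt (𝓡 n) p p) X Y Z
      = curvOf (christoffelL (inducedL (chartMetricL g' (f p))
        (writtenInExtChartAt (𝓡 n) (𝓡 k) p f))) (extChartAt (𝓡 n) p p) X Y Z :=
    (hf.isMetricOn p).coordCurvature_eq hp X Y Z
  have h4 : curvature g p X Y Z
      = curvOf (christoffelL (chartMetricL g p)) (extChartAt (𝓡 n) p p) X Y Z :=
    (isMetricOn_chartMetricL g p).coordCurvature_eq (mem_extChartAt_target p) X Y Z
  rw [h3, h4]
  simp only [curvOf]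
  rw [h2.fderiv_eq, h2.self_of_nhds]

theorem IsIsometricImmersion.fderiv_written (hf : IsIsometricImmersion g g' f) (p : M)
    (X : EuclideanSpace ℝ (Fin n)) :
    fderiv ℝ (writtenInExtChartAt (𝓡 n) (𝓡 k) p f) (extChartAt (𝓡 n) p p) X
      = mfderiv (𝓡 n) (𝓡 k) f p X := by
  rw [(hf.contMDiff.mdifferentiable (by simp) p).mfderiv, ModelWithCorners.range_eq_univ,
    fderivWithin_univ]
  rfl

end ChartMetric

/-! ### Sectional curvature determines the curvature tensor. -/

section CurvatureLike

/-- A curvature-like tensor with vanishing sectional curvature is zero. -/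
theorem curvatureLike_eq_zero {V : Type*} [AddCommGroup V] {K : V → V → V → V → ℝ}
    (add₁ : ∀ a a' b c d, K (a + a') b c d = K a b c d + K a' b c d)
    (add₃ : ∀ a b c c' d, K a b (c + c') d = K a b c d + K a b c' d)
    (anti₁₂ : ∀ a b c d, K a b c d = - K b a c d) (anti₃₄ : ∀ a b c d, K a b c d = - K a b d c)
    (bianchi : ∀ a b c d, K a b c d + K b c a d + K c a b d = 0)
    (h : ∀ x y, K x y y x = 0) (a b c d : V) : K a b c d = 0 := by
  -- Pair symmetry comes from combining four Bianchi identities; the remaining facts are sign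
  -- changes.
  have pair : ∀ a b c d, K a b c d = K c d a b := by
    intro a b c d
    linarith [bianchi a b c d, bianchi b c d a, bianchi c d a b, bianchi d a b c,
      anti₁₂ a b c d, anti₁₂ a b d c, anti₃₄ a b c d, anti₃₄ b a c d, anti₃₄ b c a d, anti₁₂ b c d a,
      anti₃₄ c a b d, anti₁₂ c a d b, anti₃₄ c d a b, anti₃₄ d a b c, anti₃₄ d b c a,
      anti₁₂ b d a c, anti₃₄ a c d b, anti₁₂ a c b d, anti₁₂ c d a b, anti₃₄ b c d a,
      anti₁₂ a c d b, anti₁₂ b d c a, anti₃₄ c a d b, anti₃₄ b d c a, anti₃₄ d b a c]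
  have add₂ : ∀ a b b' c d, K a (b + b') c d = K a b c d + K a b' c d := by
    intro a b b' c d
    rw [anti₁₂, add₁, anti₁₂ a b, anti₁₂ a b']; ring
  have add₄ : ∀ a b c d d', K a b c (d + d') = K a b c d + K a b c d' := by
    intro a b c d d'
    rw [anti₃₄, add₃, anti₃₄ a b c d, anti₃₄ a b c d']; ring
  -- Polarising in x and then in y makes K skew in its two middle slots as well. The three Bianchi
  -- terms then coincide, so 3K = 0.
  have h1 : ∀ x y z, K x y y z = 0 := by
    intro x y z
    have e := h (x + z) y
    rw [add₁, add₄, add₄, h, h] at e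
    linarith [pair x y y z, anti₁₂ y z x y, anti₃₄ z y x y]
  have h2 : ∀ x y w z, K x y w z = - K x w y z := by
    intro x y w z
    have e := h1 x (y + w) z
    rw [add₂, add₃, add₃, h1, h1] at e
    linarith
  have e1 := bianchi a b c d
  have e2 := h2 a b c d
  have e3 := anti₁₂ a c b d
  have e4 := anti₁₂ b c a d
  have e5 := h2 c b a d
  linarith

end CurvatureLike

/-! ### Expansion in an orthonormal frame. -/

section OrthonormalFrame

variable {V : Type*} [AddCommGroup V] [Module ℝ V] [FiniteDimensional ℝ V]

theorem eq_sum_of_orthonormal_frame (B : V →ₗ[ℝ] V →ₗ[ℝ] ℝ) {ι : Type*} [Fintype ι]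
    [DecidableEq ι] {b : ι → V} (hcard : Fintype.card ι = Module.finrank ℝ V)
    (hb : ∀ i j, B (b i) (b j) = if i = j then 1 else 0) (v : V) :
    v = ∑ i, B v (b i) • b i := by
  have key : ∀ (c : ι → ℝ) j, B (∑ i, c i • b i) (b j) = c j := by
    intro c j
    simp [hb]
  have hli : LinearIndependent ℝ b := by
    rw [Fintype.linearIndependent_iff]
    intro c hc j
    rw [← key c j, hc, map_zero, LinearMap.zero_apply]
  have hspan : ∃ c : ι → ℝ, ∑ i, c i • b i = v := by
    have h1 := hli.span_eq_top_of_card_eq_finrank' hcard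
    have h2 : v ∈ Submodule.span ℝ (Set.range b) := h1 ▸ Submodule.mem_top
    exact (Submodule.mem_span_range_iff_exists_fun ℝ).1 h2
  obtain ⟨c, rfl⟩ := hspan
  simp only [key]

end OrthonormalFrame

/-! ### From the matrix inequality to normalized scalar curvatures. -/

section Algebra

open Finset Matrix

/-- Pythagoras for the splitting into the traceless part and a multiple of the identity. -/
theorem frobSq_sub_trace_smul_one {n : ℕ} (hn : n ≠ 0) (A : Matrix (Fin n) (Fin n) ℝ) :
    frobSq (A - (A.trace / n) • (1 : Matrix (Fin n) (Fin n) ℝ))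
      = frobSq A - A.trace ^ 2 / n := by
  have hn' : (n : ℝ) ≠ 0 := Nat.cast_ne_zero.2 hn
  have h1 : ∀ i j, (A - (A.trace / n) • (1 : Matrix (Fin n) (Fin n) ℝ)) i j ^ 2
      = A i j ^ 2 + (if i = j then (A.trace / n) ^ 2 - 2 * (A.trace / n) * A i j else 0) := by
    intro i j
    rw [Matrix.sub_apply, Matrix.smul_apply, Matrix.one_apply]
    split_ifs
    · simp; ring
    · simp
  simp only [frobSq, h1, Finset.sum_add_distrib, Finset.sum_ite_eq, Finset.mem_univ, if_true,
    Finset.sum_sub_distrib, ← Finset.mul_sum, Finset.sum_const, Finset.card_univ,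
    Fintype.card_fin, nsmul_eq_mul]
  change _ + (_ - 2 * (A.trace / n) * A.trace) = _
  field_simp
  ring

/-- The algebraic form of the inequality, for the shape operators `A α`. -/
theorem normalized_scalar_le_of_shape {n m : ℕ} (hn : 2 ≤ n)
    (A : Fin m → Matrix (Fin n) (Fin n) ℝ) (hA : ∀ α, (A α).IsSymm) {c lam : ℝ}
    {s : Fin n → Fin n → ℝ} {r : Fin n → Fin n → Fin m → Fin m → ℝ}
    (hs : ∀ i j, i ≠ j → s i j = c + ∑ α, (A α i i * A α j j - A α i j ^ 2))
    (hr : ∀ i j α β, r i j α β = (A β * A α - A α * A β) i j)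
    (hlam : ∀ B : Fin m → Matrix (Fin n) (Fin n) ℝ, (∀ α, (B α).IsSymm) →
      (∀ α, (B α).trace = 0) →
      lam * √(∑ α, ∑ β, frobSq (B α * B β - B β * B α)) ≤ ∑ α, frobSq (B α)) :
    2 / ((n : ℝ) * ((n : ℝ) - 1)) * ∑ i, ∑ j ∈ Ioi i, s i j
      ≤ ∑ α, ((A α).trace / n) ^ 2
        - lam * (2 / ((n : ℝ) * ((n : ℝ) - 1)) *
          √(∑ i, ∑ j ∈ Ioi i, ∑ α, ∑ β ∈ Ioi α, r i j α β ^ 2)) + c := by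
  have hn' : (2 : ℝ) ≤ n := by exact_mod_cast hn
  have hn0 : n ≠ 0 := by omega
  have hn1 : (n : ℝ) ≠ 0 := by positivity
  have hpos : 0 < (n : ℝ) * ((n : ℝ) - 1) := mul_pos (by linarith) (by linarith)
  set B : Fin m → Matrix (Fin n) (Fin n) ℝ :=
    fun α => A α - ((A α).trace / n) • (1 : Matrix (Fin n) (Fin n) ℝ) with hB
  have hBs : ∀ α, (B α).IsSymm := by
    intro α
    simp only [hB, Matrix.IsSymm, Matrix.transpose_sub, Matrix.transpose_smul,
      Matrix.transpose_one, (hA α).eq]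
  have hBt : ∀ α, (B α).trace = 0 := by
    intro α
    simp only [hB, Matrix.trace_sub, Matrix.trace_smul, Matrix.trace_one, Fintype.card_fin,
      smul_eq_mul]
    field_simp
    ring
  have hcomm : ∀ α β, B α * B β - B β * B α = A α * A β - A β * A α := by
    intro α β
    simp only [hB, mul_sub, sub_mul, Matrix.smul_mul, Matrix.mul_smul, Matrix.one_mul,
      Matrix.mul_one, smul_smul, mul_comm]
    abel
  have hskew : ∀ i j α β, (A β * A α - A α * A β) i j = - (A β * A α - A α * A β) j i := by
    intro i j α β
    have h1 : (A β * A α - A α * A β)ᵀ = -(A β * A α - A α * A β) := by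
      rw [Matrix.transpose_sub, Matrix.transpose_mul, Matrix.transpose_mul, (hA α).eq, (hA β).eq,
        neg_sub]
    have h2 := congrFun (congrFun h1 j) i
    rw [Matrix.transpose_apply] at h2
    exact h2
  -- Twice the sum over i < j is the full double sum minus the diagonal. On the diagonal only c
  -- survives, whence n²c − nc.
  have hS : 2 * ∑ i, ∑ j ∈ Ioi i, s i j
      = n * (n - 1) * c + ∑ α, ((A α).trace ^ 2 - frobSq (A α)) := by
    have h1 : ∑ i, ∑ j ∈ Ioi i, s i j
        = ∑ i, ∑ j ∈ Ioi i, (c + ∑ α, (A α i i * A α j j - A α i j ^ 2)) :=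
      Finset.sum_congr rfl fun i _ => Finset.sum_congr rfl fun j hj =>
        hs i j (Finset.mem_Ioi.1 hj).ne
    have h2 := sum_sum_eq_diag_add_two_mul
      (fun i j => c + ∑ α, (A α i i * A α j j - A α i j ^ 2)) (fun i j => by
        simp only [fun α => (hA α).apply i j, mul_comm])
    have h3 : ∑ i, ∑ j, (c + ∑ α, (A α i i * A α j j - A α i j ^ 2))
        = n ^ 2 * c + ∑ α, ((A α).trace ^ 2 - frobSq (A α)) := by
      simp only [Finset.sum_add_distrib]
      congr 1
      · simp; ring
      · rw [sum_rotate₃]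
        refine Finset.sum_congr rfl fun α _ => ?_
        have ht : (A α).trace ^ 2 = ∑ i, ∑ j, A α i i * A α j j := by
          rw [sq, Matrix.trace, Finset.sum_mul_sum]
          rfl
        simp only [Finset.sum_sub_distrib, frobSq, ht]
    have h4 : ∑ i, (c + ∑ α, (A α i i * A α i i - A α i i ^ 2)) = n * c := by
      have : ∀ (i : Fin n) (α : Fin m), A α i i * A α i i - A α i i ^ 2 = 0 := fun i α => by ring
      simp [this]
    rw [h3, h4] at h2
    rw [h1]
    linarith
  -- The factor 4 counts both orders of (i,j) and of (α,β), the commutator entries being skew in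
  -- each pair.
  have hR : 4 * ∑ i, ∑ j ∈ Ioi i, ∑ α, ∑ β ∈ Ioi α, r i j α β ^ 2
      = ∑ α, ∑ β, frobSq (B α * B β - B β * B α) := by
    have h1 : ∀ i j, ∑ α, ∑ β, (A β * A α - A α * A β) i j ^ 2
        = 2 * ∑ α, ∑ β ∈ Ioi α, r i j α β ^ 2 := by
      intro i j
      rw [sum_sum_eq_diag_add_two_mul _ (fun α β => by
        rw [← neg_sub (A α * A β), Matrix.neg_apply, neg_sq])]
      simp [hr]
    have h2 : ∑ i, ∑ j, ∑ α, ∑ β, (A β * A α - A α * A β) i j ^ 2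
        = 2 * ∑ i, ∑ j ∈ Ioi i, ∑ α, ∑ β, (A β * A α - A α * A β) i j ^ 2 := by
      rw [sum_sum_eq_diag_add_two_mul _ (fun i j => Finset.sum_congr rfl fun α _ =>
        Finset.sum_congr rfl fun β _ => by rw [hskew i j, neg_sq])]
      have : ∀ i α β, (A β * A α - A α * A β) i i = 0 := fun i α β => by
        linarith [hskew i i α β]
      simp [this]
    have h3 : ∑ α, ∑ β, frobSq (B α * B β - B β * B α)
        = ∑ i, ∑ j, ∑ α, ∑ β, (A β * A α - A α * A β) i j ^ 2 := by
      simp only [hcomm, frobSq]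
      rw [sum_rotate₃]
      refine Finset.sum_congr rfl fun i _ => ?_
      rw [sum_rotate₃]
      refine Finset.sum_congr rfl fun j _ => ?_
      exact Finset.sum_comm
    rw [h3, h2]
    simp only [h1, ← Finset.mul_sum]
    ring
  have hX := hlam B hBs hBt
  rw [← hR, show (4 : ℝ) = 2 ^ 2 by norm_num, Real.sqrt_mul (by positivity),
    Real.sqrt_sq (by norm_num)] at hX
  set Y := √(∑ i, ∑ j ∈ Ioi i, ∑ α, ∑ β ∈ Ioi α, r i j α β ^ 2)
  have hT : ∑ α, frobSq (B α) = ∑ α, frobSq (A α) - (∑ α, (A α).trace ^ 2) / n := by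
    simp only [hB, frobSq_sub_trace_smul_one hn0, Finset.sum_sub_distrib, Finset.sum_div]
  rw [hT] at hX
  rw [Finset.sum_sub_distrib] at hS
  simp only [div_pow, ← Finset.sum_div]
  set T := ∑ α, (A α).trace ^ 2
  set Q := ∑ α, frobSq (A α)
  -- Over the common denominator n(n−1) the claim becomes 2 lam Y ≤ Q − T/n, which is `hX`.
  have h5 : 2 / ((n : ℝ) * ((n : ℝ) - 1)) * ∑ i, ∑ j ∈ Ioi i, s i j
      = (n * (n - 1) * c + (T - Q)) / (n * (n - 1)) := by
    rw [← hS]; ring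
  have h6 : T / (n : ℝ) ^ 2 - lam * (2 / ((n : ℝ) * ((n : ℝ) - 1)) * Y) + c
      = (T * (n - 1) / n - lam * (2 * Y) + n * (n - 1) * c) / (n * (n - 1)) := by
    have : (n : ℝ) - 1 ≠ 0 := by linarith
    field_simp
  rw [h5, h6]
  refine div_le_div_of_nonneg_right ?_ hpos.le
  have h7 : T * ((n : ℝ) - 1) / n = T - T / n := by field_simp
  rw [h7]
  linarith

end Algebra

/-! ### The curvature tensor of a space form. -/

section SpaceForm

open Filter Topology

variable {n k : ℕ}
  {M : Type*} [TopologicalSpace M] [ChartedSpace (EuclideanSpace ℝ (Fin n)) M]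
  [IsManifold (𝓡 n) ∞ M]
  {N : Type*} [TopologicalSpace N] [ChartedSpace (EuclideanSpace ℝ (Fin k)) N]
  [IsManifold (𝓡 k) ∞ N]

/-- The vector B(x,x)y − B(x,y)x has B-square equal to B(x,x) times the Gram determinant. -/
theorem gram_det_pos {V : Type*} [AddCommGroup V] [Module ℝ V] (B : V →ₗ[ℝ] V →ₗ[ℝ] ℝ)
    (symm : ∀ v w, B v w = B w v) (pos : ∀ v, v ≠ 0 → 0 < B v v) {x y : V}
    (h : LinearIndependent ℝ ![x, y]) : 0 < B x x * B y y - B x y ^ 2 := by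
  have hx : x ≠ 0 := h.ne_zero 0
  have hxx := pos x hx
  have hw : (-(B x y)) • x + B x x • y ≠ 0 := by
    intro h0
    have := (LinearIndependent.pair_iff.1 h _ _ h0).2
    exact hxx.ne' this
  have h1 := pos _ hw
  simp only [map_add, map_smul, LinearMap.add_apply, LinearMap.smul_apply, smul_eq_mul] at h1
  rw [symm y x] at h1
  have h2 : 0 < B x x * (B x x * B y y - B x y ^ 2) := by linarith
  exact pos_of_mul_pos_right h2 hxx.le

/-- The curvature tensor of a space form at a point, in the chart at this point. -/
theorem IsRealSpaceForm.curvOf_eq {g' : SmoothMetric k N} {c : ℝ} (hN : IsRealSpaceForm g' c)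
    (q : N) (a b v w : EuclideanSpace ℝ (Fin k)) :
    metricAt g' q (curvOf (christoffelL (chartMetricL g' q)) (extChartAt (𝓡 k) q q) a b v) w
      = c * (metricAt g' q b v * metricAt g' q a w - metricAt g' q a v * metricAt g' q b w) := by
  have hG := isMetricOn_chartMetricL g' q
  have hy := mem_extChartAt_target (I := 𝓡 k) q
  have hΓ := hG.isLeviCivita
  set y := extChartAt (𝓡 k) q q with hydef
  set R := curvOf (christoffelL (chartMetricL g' q)) y with hR
  have hself : ∀ v w, chartMetricL g' q y v w = metricAt g' q v w := chartMetricL_self g' q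
  have anti₁₂ : ∀ a b v, R a b v = - R b a v := fun a b v => curvOf_antisymm _ _ _ _ _
  have anti₃₄ : ∀ a b v w, metricAt g' q (R a b v) w = - metricAt g' q (R a b w) v := by
    intro a b v w
    rw [← hself, ← hself, hΓ.metric_curvOf_antisymm hy, hG.symm]
  have bianchi : ∀ a b v, R a b v + R b v a + R v a b = 0 := fun a b v =>
    hΓ.curvOf_bianchi hy a b v
  have hsec : ∀ a b, metricAt g' q (R a b b) a
      = c * (metricAt g' q a a * metricAt g' q b b - metricAt g' q a b ^ 2) := by
    intro a b
    by_cases hli : LinearIndependent ℝ ![a, b]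
    · have h1 := gram_det_pos
        (ContinuousLinearMap.toLinearMap₁₂ (metricAt g' q))
        (metricAt_symm g' q) (fun v hv => metricAt_pos g' q hv) hli
      change 0 < metricAt g' q a a * metricAt g' q b b - metricAt g' q a b ^ 2 at h1
      have h2 : sectionalCurvature g' q a b = metricAt g' q (R a b b) a
          / (metricAt g' q a a * metricAt g' q b b - metricAt g' q a b ^ 2) := by
        rw [hR, ← hG.coordCurvature_eq hy]
        rfl
      have h3 := hN q a b hli
      rw [h2, div_eq_iff h1.ne'] at h3
      exact h3
    -- For dependent vectors, where constancy of the curvature says nothing, both sides vanish.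
    · have hzero : ∀ a, R a a = 0 := by
        intro a
        funext v
        simp [hR, curvOf]
      have hdep : a = 0 ∨ ∃ t : ℝ, b = t • a := by
        by_contra hcon
        push Not at hcon
        refine hli (LinearIndependent.pair_iff.2 fun s t hst => ?_)
        by_cases ht : t = 0
        · subst ht
          rw [zero_smul, add_zero, smul_eq_zero] at hst
          exact ⟨hst.resolve_right hcon.1, rfl⟩
        · refine absurd ?_ (hcon.2 (-(t⁻¹ * s)))
          have h4 : t • b = -(s • a) := eq_neg_of_add_eq_zero_right hst
          rw [neg_smul, mul_smul, ← smul_neg, ← h4, inv_smul_smul₀ ht]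
      have hsm : ∀ (t : ℝ) a v, R a (t • a) v = 0 := by
        intro t a v
        have : R a (t • a) v = t • R a a v := by
          simp only [hR, curvOf, map_smul, smul_apply, smul_sub, smul_add]
        rw [this, hzero]; simp
      rcases hdep with rfl | ⟨t, rfl⟩
      · simp
      · rw [hsm]
        simp only [map_zero, map_smul, zero_apply,
          smul_apply, smul_eq_mul]
        ring
  have radd₁ : ∀ a a' b v, R (a + a') b v = R a b v + R a' b v := by
    intro a a' b v
    simp only [hR, curvOf, map_add, add_apply]
    abel
  have radd₃ : ∀ a b v v', R a b (v + v') = R a b v + R a b v' := by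
    intro a b v v'
    simp only [hR, curvOf, map_add]
    abel
  have hsym := metricAt_symm g' q
  -- Applied to the difference between the curvature tensor and its constant curvature model.
  have key := curvatureLike_eq_zero (K := fun a b v w => metricAt g' q (R a b v) w
      - c * (metricAt g' q b v * metricAt g' q a w - metricAt g' q a v * metricAt g' q b w))
    (fun a a' b v w => by
      simp only [radd₁, map_add, add_apply]; ring)
    (fun a b v v' w => by
      simp only [radd₃, map_add, add_apply]; ring)
    (fun a b v w => by
      simp only [anti₁₂ a b v, map_neg, neg_apply]; ring)
    (fun a b v w => by
      rw [anti₃₄ a b v w]; ring)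
    (fun a b v w => by
      have := congrArg (fun z => metricAt g' q z w) (bianchi a b v)
      simp only [map_add, add_apply, map_zero, zero_apply] at this
      rw [hsym v a, hsym v b, hsym b a]
      linarith)
    (fun a b => by
      rw [hsec, hsym b a]; ring) a b v w
  linarith

end SpaceForm

/-! ### The Gauss and Ricci equations at a point of the manifold. -/

section ShapeOperators

open Filter Topology

variable {n k : ℕ}
  {M : Type*} [TopologicalSpace M] [ChartedSpace (EuclideanSpace ℝ (Fin n)) M]
  [IsManifold (𝓡 n) ∞ M]
  {N : Type*} [TopologicalSpace N] [ChartedSpace (EuclideanSpace ℝ (Fin k)) N]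
  [IsManifold (𝓡 k) ∞ N]
  {g : SmoothMetric n M} {g' : SmoothMetric k N} {f : M → N}

/-- The differential of `f` at `p`, as a linear map between the model spaces. -/
def derivAt (n k : ℕ) {M N : Type*} [TopologicalSpace M]
    [ChartedSpace (EuclideanSpace ℝ (Fin n)) M] [TopologicalSpace N]
    [ChartedSpace (EuclideanSpace ℝ (Fin k)) N] (f : M → N) (p : M) :
    EuclideanSpace ℝ (Fin n) →L[ℝ] EuclideanSpace ℝ (Fin k) := mfderiv (𝓡 n) (𝓡 k) f p

/-- The second fundamental form at `p`, as a map between the model spaces. -/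
def secondForm (n k : ℕ) {M N : Type*} [TopologicalSpace M]
    [ChartedSpace (EuclideanSpace ℝ (Fin n)) M] [TopologicalSpace N]
    [ChartedSpace (EuclideanSpace ℝ (Fin k)) N] [IsManifold (𝓡 k) ∞ N]
    (g' : SmoothMetric k N) (f : M → N) (p : M)
    (X Y : EuclideanSpace ℝ (Fin n)) : EuclideanSpace ℝ (Fin k) :=
  secondFundamentalForm (n := n) g' f p X Y

theorem chartMetricL_written (g' : SmoothMetric k N) (f : M → N) (p : M)
    (v w : EuclideanSpace ℝ (Fin k)) :
    chartMetricL g' (f p) (writtenInExtChartAt (𝓡 n) (𝓡 k) p f (extChartAt (𝓡 n) p p)) v w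
      = metricAt g' (f p) v w := by
  rw [written_self, chartMetricL_self]

theorem IsIsometricImmersion.fderiv_written_eq (hf : IsIsometricImmersion g g' f) (p : M) :
    fderiv ℝ (writtenInExtChartAt (𝓡 n) (𝓡 k) p f) (extChartAt (𝓡 n) p p) = derivAt n k f p := by
  ext X : 1
  exact hf.fderiv_written p X

theorem IsIsometricImmersion.secondForm_eq (hf : IsIsometricImmersion g g' f) (p : M)
    (X Y : EuclideanSpace ℝ (Fin n)) :
    secondForm n k g' f p X Y = secondFormOf (christoffelL (chartMetricL g' (f p)))
      (christoffelL (inducedL (chartMetricL g' (f p)) (writtenInExtChartAt (𝓡 n) (𝓡 k) p f)))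
      (writtenInExtChartAt (𝓡 n) (𝓡 k) p f) (extChartAt (𝓡 n) p p) X Y :=
  coordSecondFundamentalForm_eq (isMetricOn_chartMetricL g' (f p)) (hf.isSmoothMap p)
    (hf.isMetricOn p) (mem_chartDomain f p) X Y

theorem IsIsometricImmersion.secondForm_normal (hf : IsIsometricImmersion g g' f) (p : M)
    (X Y Z : EuclideanSpace ℝ (Fin n)) :
    metricAt g' (f p) (secondForm n k g' f p X Y) (derivAt n k f p Z) = 0 := by
  rw [hf.secondForm_eq, ← hf.fderiv_written_eq, ← chartMetricL_written (n := n)]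
  exact ((isMetricOn_chartMetricL g' (f p)).isInducedConnection (hf.isSmoothMap p)
    (hf.isMetricOn p)).normal _ (mem_chartDomain f p) X Y Z

theorem IsIsometricImmersion.secondForm_symm (hf : IsIsometricImmersion g g' f) (p : M)
    (X Y : EuclideanSpace ℝ (Fin n)) :
    secondForm n k g' f p X Y = secondForm n k g' f p Y X := by
  rw [hf.secondForm_eq, hf.secondForm_eq, secondFormOf, secondFormOf,
    (isMetricOn_chartMetricL g' (f p)).isLeviCivita.covAlong_fderiv_comm (hf.isSmoothMap p)
      (mem_chartDomain f p),
    (hf.isMetricOn p).isLeviCivita.torsion _ (mem_chartDomain f p)]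

/-- Linearity in the second argument, needed to expand h(e_i, S e_j) in the frame. -/
theorem IsIsometricImmersion.exists_secondForm_eq (hf : IsIsometricImmersion g g' f) (p : M)
    (X : EuclideanSpace ℝ (Fin n)) :
    ∃ Λ : EuclideanSpace ℝ (Fin n) →L[ℝ] EuclideanSpace ℝ (Fin k),
      ∀ Y, secondForm n k g' f p X Y = Λ Y := by
  have hF2 := ((hf.isSmoothMap p).contDiffAt _
    (mem_chartDomain f p)).fderiv_infty.differentiableAt_infty
  set F := writtenInExtChartAt (𝓡 n) (𝓡 k) p f
  set x := extChartAt (𝓡 n) p p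
  set 𝒢 := chartMetricL g' (f p)
  refine ⟨fderiv ℝ (fderiv ℝ F) x X
    + (christoffelL 𝒢 (F x) (fderiv ℝ F x X)).comp (fderiv ℝ F x)
    - (fderiv ℝ F x).comp (christoffelL (inducedL 𝒢 F) x X), fun Y => ?_⟩
  rw [hf.secondForm_eq, secondFormOf, covAlong, fderiv_fderiv_apply hF2]
  rfl

theorem IsIsometricImmersion.gauss (hf : IsIsometricImmersion g g' f) (p : M) {c : ℝ}
    (hN : IsRealSpaceForm g' c) (X Y Z W : EuclideanSpace ℝ (Fin n)) :
    metricAt g p (curvature g p X Y Z) W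
      = c * (metricAt g p Y Z * metricAt g p X W - metricAt g p X Z * metricAt g p Y W)
        + metricAt g' (f p) (secondForm n k g' f p Y Z) (secondForm n k g' f p X W)
        - metricAt g' (f p) (secondForm n k g' f p X Z) (secondForm n k g' f p Y W) := by
  have h1 := gauss_equation_coord (isMetricOn_chartMetricL g' (f p)) (hf.isSmoothMap p)
    (hf.isMetricOn p) (mem_chartDomain f p) X Y Z W
  have hL : ∀ X Y, metricAt g' (f p) (derivAt n k f p X) (derivAt n k f p Y) = metricAt g p X Y :=
    hf.isometric p
  rw [hf.chartMetricL_eq p (mem_chartDomain f p), chartMetricL_self] at h1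
  simp only [chartMetricL_written, hf.fderiv_written_eq] at h1
  rw [written_self, hN.curvOf_eq] at h1
  simp only [hL] at h1
  rw [hf.curvature_eq]
  exact h1

theorem IsIsometricImmersion.ricci (hf : IsIsometricImmersion g g' f) (p : M) {c : ℝ}
    (hN : IsRealSpaceForm g' c) {ξ η : EuclideanSpace ℝ (Fin k)}
    (hξ : ∀ Z, metricAt g' (f p) ξ (derivAt n k f p Z) = 0)
    (hη : ∀ Z, metricAt g' (f p) η (derivAt n k f p Z) = 0) :
    ∃ S : EuclideanSpace ℝ (Fin n) → EuclideanSpace ℝ (Fin n),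
      (∀ W Z, metricAt g p (S W) Z = - metricAt g' (f p) ξ (secondForm n k g' f p W Z)) ∧
      ∀ X Y : EuclideanSpace ℝ (Fin n),
        metricAt g' (f p) (normalCurvature (n := n) g' f p X Y ξ) η
        = metricAt g' (f p) (secondForm n k g' f p Y (S X)) η
          - metricAt g' (f p) (secondForm n k g' f p X (S Y)) η := by
  obtain ⟨S, hS, hR⟩ := ricci_equation_coord (isMetricOn_chartMetricL g' (f p)) (hf.isSmoothMap p)
    (hf.isMetricOn p) (mem_chartDomain f p) (ξ := ξ) (η := η)
    (fun Z => by rw [chartMetricL_written, hf.fderiv_written_eq, hξ])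
    (fun Z => by rw [chartMetricL_written, hf.fderiv_written_eq, hη])
  refine ⟨S, fun W Z => ?_, fun X Y => ?_⟩
  · have h1 := hS W Z
    rw [hf.chartMetricL_eq p (mem_chartDomain f p), chartMetricL_self, chartMetricL_written] at h1
    exact h1
  · have h1 := hR X Y
    simp only [chartMetricL_written, hf.fderiv_written_eq] at h1
    have hξ' : ∀ Z, metricAt g' (f p) (derivAt n k f p Z) ξ = 0 := fun Z => by
      rw [metricAt_symm, hξ]
    -- In constant curvature R(X,Y)ξ pairs ξ with the tangent vectors dfX and dfY, so the ambient
    -- term vanishes.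
    rw [written_self, hN.curvOf_eq, hξ' X, hξ' Y] at h1
    refine Eq.trans h1 ?_
    change c * (0 * _ - 0 * _) - metricAt g' (f p) (secondForm n k g' f p X (S Y)) η
      + metricAt g' (f p) (secondForm n k g' f p Y (S X)) η = _
    ring

end ShapeOperators

/-! ### Curvatures in terms of the shape operators. -/

section ShapeOperators

variable {n m : ℕ}
  {M : Type*} [TopologicalSpace M] [ChartedSpace (EuclideanSpace ℝ (Fin n)) M]
  [IsManifold (𝓡 n) ∞ M]
  {N : Type*} [TopologicalSpace N] [ChartedSpace (EuclideanSpace ℝ (Fin (n + m))) N]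
  [IsManifold (𝓡 (n + m)) ∞ N]
  {g : SmoothMetric n M} {g' : SmoothMetric (n + m) N} {f : M → N}

/-- The metric of `N` on normal vectors, computed in an orthonormal normal frame. -/
theorem IsIsometricImmersion.metric_eq_sum_normal (hf : IsIsometricImmersion g g' f) {p : M}
    {e : Fin n → EuclideanSpace ℝ (Fin n)}
    (he : ∀ i j, metricAt g p (e i) (e j) = if i = j then 1 else 0)
    {u : Fin m → EuclideanSpace ℝ (Fin (n + m))}
    (hu : ∀ α β, metricAt g' (f p) (u α) (u β) = if α = β then 1 else 0)
    (hu' : ∀ α Z, metricAt g' (f p) (u α) (derivAt n (n + m) f p Z) = 0)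
    {v : EuclideanSpace ℝ (Fin (n + m))}
    (hv : ∀ Z, metricAt g' (f p) v (derivAt n (n + m) f p Z) = 0)
    (w : EuclideanSpace ℝ (Fin (n + m))) :
    metricAt g' (f p) v w
      = ∑ α, metricAt g' (f p) v (u α) * metricAt g' (f p) w (u α) := by
  have hL : ∀ X Y, metricAt g' (f p) (derivAt n (n + m) f p X) (derivAt n (n + m) f p Y)
      = metricAt g p X Y := hf.isometric p
  -- The images of the e_i together with the u_α are n + m orthonormal vectors, hence a basis; the
  -- normal vector v pairs only with the u_α.
  have h1 := eq_sum_of_orthonormal_frame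
    (ContinuousLinearMap.toLinearMap₁₂ (metricAt g' (f p)))
    (b := Sum.elim (fun i => derivAt n (n + m) f p (e i)) u) (by simp)
    (fun a b => by
      change metricAt g' (f p) _ _ = _
      rcases a with i | α <;> rcases b with j | β
      · simp [hL, he]
      · simp [metricAt_symm g' (f p) _ (u β), hu']
      · simp [hu']
      · simp [hu]) w
  rw [Fintype.sum_sum_type] at h1
  change w = ∑ i, metricAt g' (f p) w (derivAt n (n + m) f p (e i)) • derivAt n (n + m) f p (e i)
    + ∑ α, metricAt g' (f p) w (u α) • u α at h1
  have h2 := congrArg (fun z => metricAt g' (f p) v z) h1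
  simp only [map_add, map_sum, map_smul, smul_eq_mul, hv, mul_zero, Finset.sum_const_zero,
    zero_add] at h2
  rw [h2]
  exact Finset.sum_congr rfl fun α _ => mul_comm _ _

/-- The shape operators of the normal frame `u`, in the frame `e`. -/
def shapeMatrix (g' : SmoothMetric (n + m) N) (f : M → N) (p : M)
    (e : Fin n → EuclideanSpace ℝ (Fin n)) (u : Fin m → EuclideanSpace ℝ (Fin (n + m)))
    (α : Fin m) : Matrix (Fin n) (Fin n) ℝ :=
  Matrix.of fun i j => metricAt g' (f p) (secondForm n (n + m) g' f p (e i) (e j)) (u α)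

theorem IsIsometricImmersion.shapeMatrix_isSymm (hf : IsIsometricImmersion g g' f) {p : M}
    (e : Fin n → EuclideanSpace ℝ (Fin n)) (u : Fin m → EuclideanSpace ℝ (Fin (n + m)))
    (α : Fin m) : (shapeMatrix g' f p e u α).IsSymm := by
  ext i j
  simp only [shapeMatrix, Matrix.transpose_apply, Matrix.of_apply]
  rw [hf.secondForm_symm]

theorem IsIsometricImmersion.sectional_eq_shape (hf : IsIsometricImmersion g g' f) {p : M} {c : ℝ}
    (hN : IsRealSpaceForm g' c)
    {e : Fin n → EuclideanSpace ℝ (Fin n)}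
    (he : ∀ i j, metricAt g p (e i) (e j) = if i = j then 1 else 0)
    {u : Fin m → EuclideanSpace ℝ (Fin (n + m))}
    (hu : ∀ α β, metricAt g' (f p) (u α) (u β) = if α = β then 1 else 0)
    (hu' : ∀ α Z, metricAt g' (f p) (u α) (derivAt n (n + m) f p Z) = 0)
    {i j : Fin n} (hij : i ≠ j) :
    metricAt g p (curvature g p (e i) (e j) (e j)) (e i)
      = c + ∑ α, (shapeMatrix g' f p e u α i i * shapeMatrix g' f p e u α j j
        - shapeMatrix g' f p e u α i j ^ 2) := by
  rw [hf.gauss p hN, hf.metric_eq_sum_normal he hu hu' (hf.secondForm_normal p _ _),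
    hf.metric_eq_sum_normal he hu hu' (hf.secondForm_normal p _ _), he, he, he, he,
    Finset.sum_sub_distrib, hf.secondForm_symm p (e j) (e i)]
  simp only [shapeMatrix, Matrix.of_apply, hij, hij.symm, if_true, if_false, sq]
  simp only [mul_comm]
  ring

theorem IsIsometricImmersion.meanCurvatureSq_eq_shape (hf : IsIsometricImmersion g g' f) {p : M}
    {e : Fin n → EuclideanSpace ℝ (Fin n)}
    (he : ∀ i j, metricAt g p (e i) (e j) = if i = j then 1 else 0)
    {u : Fin m → EuclideanSpace ℝ (Fin (n + m))}
    (hu : ∀ α β, metricAt g' (f p) (u α) (u β) = if α = β then 1 else 0)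
    (hu' : ∀ α Z, metricAt g' (f p) (u α) (derivAt n (n + m) f p Z) = 0) :
    meanCurvatureSq g' f p e = ∑ α, ((shapeMatrix g' f p e u α).trace / n) ^ 2 := by
  set H : EuclideanSpace ℝ (Fin (n + m)) :=
    (1 / (n : ℝ)) • ∑ i, secondForm n (n + m) g' f p (e i) (e i) with hH
  have h0 : meanCurvatureSq g' f p e = metricAt g' (f p) H H := rfl
  have hHn : ∀ Z, metricAt g' (f p) H (derivAt n (n + m) f p Z) = 0 := by
    intro Z
    simp [hH, map_sum, hf.secondForm_normal]
  rw [h0, hf.metric_eq_sum_normal he hu hu' hHn]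
  refine Finset.sum_congr rfl fun α _ => ?_
  have h1 : metricAt g' (f p) H (u α) = (shapeMatrix g' f p e u α).trace / n := by
    simp only [hH, map_smul, map_sum, smul_apply, sum_apply, smul_eq_mul,
      Matrix.trace, Matrix.diag, shapeMatrix, Matrix.of_apply]
    ring
  rw [h1, sq]

theorem IsIsometricImmersion.normalCurvature_eq_shape (hf : IsIsometricImmersion g g' f) {p : M}
    {c : ℝ} (hN : IsRealSpaceForm g' c)
    {e : Fin n → EuclideanSpace ℝ (Fin n)}
    (he : ∀ i j, metricAt g p (e i) (e j) = if i = j then 1 else 0)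
    {u : Fin m → EuclideanSpace ℝ (Fin (n + m))}
    (hu' : ∀ α Z, metricAt g' (f p) (u α) (derivAt n (n + m) f p Z) = 0)
    (i j : Fin n) (α β : Fin m) :
    metricAt g' (f p) (normalCurvature (n := n) g' f p (e i) (e j) (u α)) (u β)
      = (shapeMatrix g' f p e u β * shapeMatrix g' f p e u α
        - shapeMatrix g' f p e u α * shapeMatrix g' f p e u β) i j := by
  obtain ⟨S, hS, hR⟩ := hf.ricci p hN (hu' α) (hu' β)
  -- S is minus the shape operator of u_α. Expanding it in the frame turns the two Ricci terms into
  -- entries of matrix products.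
  have h1 : ∀ i, S (e i) = ∑ k, (-shapeMatrix g' f p e u α i k) • e k := by
    intro i
    refine (eq_sum_of_orthonormal_frame (ContinuousLinearMap.toLinearMap₁₂ (metricAt g p))
      (by simp) he (S (e i))).trans (Finset.sum_congr rfl fun k _ => ?_)
    congr 1
    refine (hS (e i) (e k)).trans ?_
    rw [metricAt_symm]
    rfl
  have h2 : ∀ i j, metricAt g' (f p) (secondForm n (n + m) g' f p (e i) (S (e j))) (u β)
      = -∑ k, shapeMatrix g' f p e u α j k * shapeMatrix g' f p e u β i k := by
    intro i j
    obtain ⟨Λ, hΛ⟩ := hf.exists_secondForm_eq p (e i)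
    rw [h1, hΛ]
    simp only [map_sum, map_smul, sum_apply, smul_apply, smul_eq_mul, neg_mul,
      Finset.sum_neg_distrib]
    simp only [← hΛ]
    rfl
  have hsymm : ∀ α i j, shapeMatrix g' f p e u α i j = shapeMatrix g' f p e u α j i :=
    fun α i j => (hf.shapeMatrix_isSymm e u α).apply j i
  rw [hR, h2, h2, Matrix.sub_apply, Matrix.mul_apply, Matrix.mul_apply]
  have h3 : ∑ k, shapeMatrix g' f p e u α j k * shapeMatrix g' f p e u β i k
      = ∑ k, shapeMatrix g' f p e u β i k * shapeMatrix g' f p e u α k j :=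
    Finset.sum_congr rfl fun k _ => by rw [hsymm α j k, mul_comm]
  have h4 : ∑ k, shapeMatrix g' f p e u α i k * shapeMatrix g' f p e u β j k
      = ∑ k, shapeMatrix g' f p e u α i k * shapeMatrix g' f p e u β k j :=
    Finset.sum_congr rfl fun k _ => by rw [hsymm β j k]
  rw [h3, h4]
  ring

/-- All the geometry at once, for any constant `lam` admissible in the matrix inequality for
traceless symmetric matrices. -/
theorem IsIsometricImmersion.normalized_scalar_le (hf : IsIsometricImmersion g g' f) (hn : 2 ≤ n)
    {c : ℝ} (hN : IsRealSpaceForm g' c) {p : M} {e : Fin n → TangentSpace (𝓡 n) p}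
    (he : IsOrthonormalFrame g p e) {u : Fin m → TangentSpace (𝓡 (n + m)) (f p)}
    (hu : IsOrthonormalNormalFrame g' f p u) {lam : ℝ}
    (hlam : ∀ B : Fin m → Matrix (Fin n) (Fin n) ℝ, (∀ α, (B α).IsSymm) →
      (∀ α, (B α).trace = 0) →
      lam * √(∑ α, ∑ β, frobSq (B α * B β - B β * B α)) ≤ ∑ α, frobSq (B α)) :
    normalizedScalarCurvature g p e
      ≤ meanCurvatureSq g' f p e - lam * normalizedNormalScalarCurvature g' f p e u + c := by
  have he' : ∀ i j, metricAt g p (e i) (e j) = if i = j then 1 else 0 := he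
  have hu1 : ∀ α β, metricAt g' (f p) (u α) (u β) = if α = β then 1 else 0 := hu.orthonormal
  have hu2 : ∀ α Z, metricAt g' (f p) (u α) (derivAt n (n + m) f p Z) = 0 := hu.normal
  rw [hf.meanCurvatureSq_eq_shape he' hu1 hu2]
  exact normalized_scalar_le_of_shape hn (shapeMatrix g' f p e u)
    (fun α => hf.shapeMatrix_isSymm e u α)
    (fun i j hij => hf.sectional_eq_shape hN he' hu1 hu2 hij)
    (fun i j α β => hf.normalCurvature_eq_shape hN he' hu2 i j α β) hlam

end ShapeOperators

end Submfd

end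

theorem mainTheorem2 {n m : ℕ} (hn : 2 ≤ n)
    {M : Type*} [TopologicalSpace M] [ChartedSpace (EuclideanSpace ℝ (Fin n)) M]
    [IsManifold (𝓡 n) ∞ M]
    {N : Type*} [TopologicalSpace N] [ChartedSpace (EuclideanSpace ℝ (Fin (n + m))) N]
    [IsManifold (𝓡 (n + m)) ∞ N]
    (g : Submfd.SmoothMetric n M) (g' : Submfd.SmoothMetric (n + m) N) (c : ℝ)
    (hN : Submfd.IsRealSpaceForm g' c)
    (f : M → N) (hf : Submfd.IsIsometricImmersion g g' f)
    (p : M)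
    (e : Fin n → TangentSpace (𝓡 n) p) (he : Submfd.IsOrthonormalFrame g p e)
    (u : Fin m → TangentSpace (𝓡 (n + m)) (f p))
    (hu : Submfd.IsOrthonormalNormalFrame g' f p u) :
    (2 ≤ m →
      Submfd.normalizedScalarCurvature g p e ≤
        Submfd.meanCurvatureSq g' f p e
          - √((2 * (m : ℝ) - 1) / (3 * (m : ℝ) - 3))
            * Submfd.normalizedNormalScalarCurvature g' f p e u
          + c) ∧
    Submfd.normalizedScalarCurvature g p e ≤
      Submfd.meanCurvatureSq g' f p e
        - √((2 / 3) * (((n : ℝ) ^ 2 + (n : ℝ) - 3) / ((n : ℝ) ^ 2 + (n : ℝ) - 4)))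
          * Submfd.normalizedNormalScalarCurvature g' f p e u
        + c :=
  -- Part (i) bounds the span of the B_α by their number m, part (ii) by the dimension of the
  -- traceless symmetric matrices.
  ⟨fun hm => hf.normalized_scalar_le hn hN he hu fun B hB _ =>
      Submfd.normal_scalar_matrix_inequality_codim hm B hB,
    hf.normalized_scalar_le hn hN he hu fun B hB htr =>
      Submfd.normal_scalar_matrix_inequality_dim hn B hB htr⟩
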